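/- Let $K$ be a field and let $q,t\in K^{\times}$ satisfy $q^a t^b\neq 1$ for all integers $a,b\ge 0$ with $(a,b)\neq(0,0)$ (for instance $K=\mathbb{Q}(q,t)$ with $q,t$ indeterminates, or $K=\mathbb{R}$ with $0<q,t<1$). Let $n\ge 1$, $x=(x_1,\dots,x_n)$ and $\underline{x}=(x_n,\dots,x_1)$; for $\eta\in\mathbb{Z}^n$ put $\underline{\eta}=(\eta_n,\dots,\eta_1)$ and $x^{\eta}=x_1^{\eta_1}\cdots x_n^{\eta_n}$. On $K[x_1^{\pm1},\dots,x_n^{\pm1}]$ let $s_i$ interchange $x_i$ and $x_{i+1}$, let $\tau_1$ be the substitution $x_1\mapsto qx_1$, and put $$T_i=t+\frac{tx_i-x_{i+1}}{x_i-x_{i+1}}(s_i-1)\quad(1\le i\le n-1),\qquad \omega=s_{n-1}\cdots s_1\tau_1,$$ $$Y_i=t^{-n+i}\,T_i\cdots T_{n-1}\,\omega\,T_1^{-1}\cdots T_{i-1}^{-1}\quad(1\le i\le n).$$ For $\eta\in\mathbb{Z}^n$ let $\eta^+$ be its weakly decreasing rearrangement and $$l'_\eta(i)=\#\{k<i:\eta_k\ge\eta_i\}+\#\{k>i:\eta_k>\eta_i\}.$$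 Write $\nu<\eta$ if $\nu\ne\eta$ and $\sum_{i\le p}\nu_i\le\sum_{i\le p}\eta_i$ for $1\le p\le n$; write $\nu\prec\eta$ if $\sum_i\nu_i=\sum_i\eta_i$ and either $\nu^+<\eta^+$, or $\nu^+=\eta^+$ and $\nu<\eta$. Then for every $\eta\in\mathbb{Z}^n$ there is exactly one Laurent polynomial $E_\eta(x;q,t)$ (the non-symmetric Macdonald Laurent polynomial) with $$E_\eta(x;q,t)=x^\eta+\sum_{\nu\prec\eta}b_{\eta\nu}x^\nu\quad(b_{\eta\nu}\in K),\qquad Y_iE_\eta(x;q,t)=q^{\eta_i}t^{-l'_\eta(i)}E_\eta(x;q,t)\quad(1\le i\le n).$$ Define the dual polynomials by $\hat E_\eta(x;q,t)=E_\eta(\underline{x};q^{-1},t^{-1})$. Then, with $1/x=(1/x_1,\dots,1/x_n)$, for every $\eta\in\mathbb{Z}^n$ $$E_\eta(1/x;q,t)=E_{-\underline{\eta}}(\underline{x};q,t)\qquad\text{and}\qquad \hat E_\eta(1/x;q,t)=\hat E_{-\underline{\eta}}(\underline{x};q,t).$$ -/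

import Mathlib

noncomputable section

namespace NonsymMacdonald

/-- Laurent polynomials over `K` in the `n + 1` variables `x_0, …, x_n`, as finitely supported
combinations of the monomials `x ^ η` with `η : Fin (n + 1) → ℤ`. -/
abbrev Laurent (K : Type*) [Field K] (n : ℕ) : Type _ := AddMonoidAlgebra K (Fin (n + 1) → ℤ)

section Operators

variable {K : Type*} [Field K] {n : ℕ}

/-- The monomial `x ^ η`. -/
def mono (η : Fin (n + 1) → ℤ) : Laurent K n := AddMonoidAlgebra.single η 1

/-- The variable `x_j`. -/
def X (j : Fin (n + 1)) : Laurent K n := mono (Pi.single j 1)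

/-- The linear operator with prescribed values `g η` on the monomials `x ^ η`. -/
def onMono (g : (Fin (n + 1) → ℤ) → Laurent K n) : Module.End K (Laurent K n) :=
  Finsupp.linearCombination K g ∘ₗ (AddMonoidAlgebra.coeffLinearEquiv K).toLinearMap

theorem onMono_mono (g : (Fin (n + 1) → ℤ) → Laurent K n) (η : Fin (n + 1) → ℤ) :
    onMono g (mono η) = g η := by
  simp [onMono, mono]

theorem end_ext {A B : Module.End K (Laurent K n)}
    (h : ∀ η, A (mono η) = B (mono η)) : A = B := by
  refine AddMonoidAlgebra.lhom_ext' fun η => LinearMap.ext_ring ?_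
  exact h η

theorem end_ext' {A B : Module.End K (Laurent K n)}
    (h : ∀ η, A (mono η) = B (mono η)) (f : Laurent K n) : A f = B f := by
  rw [end_ext h]

theorem mono_mul_mono (η ν : Fin (n + 1) → ℤ) :
    (mono η * mono ν : Laurent K n) = mono (η + ν) := by
  simp [mono, AddMonoidAlgebra.single_mul_single]

/-- The substitution `x_j ↦ x_{σ j}` for all `j`, so that `x ^ η` goes to `x ^ (η ∘ σ⁻¹)`. -/
def permVars (σ : Equiv.Perm (Fin (n + 1))) : Module.End K (Laurent K n) :=
  onMono fun η => mono (η ∘ σ.symm)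

/-- `f(x_0, …, x_n) ↦ f(x_n, …, x_0)`. -/
def revVars : Module.End K (Laurent K n) := permVars Fin.revPerm

/-- `f(x) ↦ f(1 / x)`, i.e. `x_j ↦ x_j⁻¹` for all `j`. -/
def invVars : Module.End K (Laurent K n) := onMono fun η => mono (-η)

/-- The `q`-shift `τ_j`, i.e. the substitution `x_j ↦ q x_j`. -/
def tau (q : K) (j : Fin (n + 1)) : Module.End K (Laurent K n) :=
  onMono fun η => q ^ η j • mono η

/-- The operator interchanging the adjacent variables `x_j` and `x_{j+1}`. -/
def s (j : Fin n) : Module.End K (Laurent K n) := permVars (Equiv.swap j.castSucc j.succ)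

/-- The exponent vector that is `u` at `j`, `v` at `j + 1` and agrees with `η` elsewhere. -/
def setPair (η : Fin (n + 1) → ℤ) (j : Fin n) (u v : ℤ) : Fin (n + 1) → ℤ :=
  Function.update (Function.update η j.castSucc u) j.succ v

/-- The divided difference `f ↦ (s_j f - f) / (x_j - x_{j+1})`, written out on monomials
(see `sub_mul_divDiff`). -/
def divDiff (j : Fin n) : Module.End K (Laurent K n) :=
  onMono fun η =>
    (∑ k ∈ Finset.range (η j.succ - η j.castSucc).toNat,
        mono (setPair η j (η j.castSucc + k) (η j.succ - 1 - k)))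
      - ∑ k ∈ Finset.range (η j.castSucc - η j.succ).toNat,
        mono (setPair η j (η j.succ + k) (η j.castSucc - 1 - k))

theorem s_mono (j : Fin n) (η : Fin (n + 1) → ℤ) :
    (s j (mono η) : Laurent K n) = mono (setPair η j (η j.succ) (η j.castSucc)) := by
  have hne : j.castSucc ≠ j.succ := (Fin.castSucc_lt_succ (i := j)).ne
  rw [s, permVars, onMono_mono]
  congr 1
  funext k
  by_cases h2 : k = j.succ
  · subst h2; simp [setPair]
  by_cases h1 : k = j.castSucc
  · subst h1; simp [setPair, hne]
  simp [setPair, h1, h2, Equiv.swap_apply_of_ne_of_ne h1 h2]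

theorem X_mul_setPair_left (j : Fin n) (η : Fin (n + 1) → ℤ) (u v : ℤ) :
    (X j.castSucc * mono (setPair η j u v) : Laurent K n) = mono (setPair η j (u + 1) v) := by
  have hne : j.castSucc ≠ j.succ := (Fin.castSucc_lt_succ (i := j)).ne
  rw [X, mono_mul_mono]
  congr 1
  funext k
  by_cases h2 : k = j.succ
  · subst h2; simp [setPair, hne.symm]
  by_cases h1 : k = j.castSucc
  · subst h1; simp [setPair, hne, add_comm]
  simp [setPair, h1, h2]

theorem X_mul_setPair_right (j : Fin n) (η : Fin (n + 1) → ℤ) (u v : ℤ) :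
    (X j.succ * mono (setPair η j u v) : Laurent K n) = mono (setPair η j u (v + 1)) := by
  have hne : j.castSucc ≠ j.succ := (Fin.castSucc_lt_succ (i := j)).ne
  rw [X, mono_mul_mono]
  congr 1
  funext k
  by_cases h2 : k = j.succ
  · subst h2; simp [setPair, add_comm]
  by_cases h1 : k = j.castSucc
  · subst h1; simp [setPair, hne]
  simp [setPair, h1, h2]

theorem setPair_self (j : Fin n) (η : Fin (n + 1) → ℤ) :
    setPair η j (η j.castSucc) (η j.succ) = η := by
  simp [setPair]

theorem telescope (j : Fin n) (η : Fin (n + 1) → ℤ) (a c : ℤ) (d : ℕ) :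
    (X j.castSucc - X j.succ) * ∑ k ∈ Finset.range d, mono (setPair η j (a + k) (c - 1 - k))
      = (mono (setPair η j (a + d) (c - d)) - mono (setPair η j a c) : Laurent K n) := by
  rw [Finset.mul_sum]
  have := Finset.sum_range_sub
    (fun k : ℕ => (mono (setPair η j (a + k) (c - k)) : Laurent K n)) d
  simp only [Nat.cast_zero, add_zero, sub_zero] at this
  rw [← this]
  refine Finset.sum_congr rfl fun k _ => ?_
  rw [sub_mul, X_mul_setPair_left, X_mul_setPair_right]
  congr 3 <;> push_cast <;> ring

/-- `divDiff j f` is the exact quotient of `s_j f - f` by `x_j - x_{j+1}`. -/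
theorem sub_mul_divDiff (j : Fin n) (f : Laurent K n) :
    (X j.castSucc - X j.succ) * divDiff j f = s j f - f := by
  refine end_ext' (A := LinearMap.mulLeft K (X j.castSucc - X j.succ) * divDiff j)
    (B := s j - 1) (fun η => ?_) f
  simp only [Module.End.mul_apply, LinearMap.mulLeft_apply, LinearMap.sub_apply,
    Module.End.one_apply, s_mono]
  rw [divDiff, onMono_mono, mul_sub, telescope, telescope]
  rcases le_total (η j.castSucc) (η j.succ) with h | h
  · rw [Int.toNat_of_nonneg (by omega), Int.toNat_of_nonpos (by omega)]
    simp [setPair_self]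
  · rw [Int.toNat_of_nonneg (a := η j.castSucc - η j.succ) (by omega),
      Int.toNat_of_nonpos (by omega)]
    simp [setPair_self]

/-- The Demazure-Lustig operator
`T_j = t + (t x_j - x_{j+1}) / (x_j - x_{j+1}) (s_j - 1)`. -/
def T (t : K) (j : Fin n) : Module.End K (Laurent K n) :=
  t • 1 + LinearMap.mulLeft K (t • X j.castSucc - X j.succ) * divDiff j

/-- The inverse `T_j⁻¹ = t⁻¹ - 1 + t⁻¹ T_j` (see `T_mul_Tinv` and `Tinv_mul_T`). -/
def Tinv (t : K) (j : Fin n) : Module.End K (Laurent K n) :=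
  (t⁻¹ - 1) • 1 + t⁻¹ • T t j

theorem s_mul (j : Fin n) (f g : Laurent K n) : s j (f * g) = s j f * s j g := by
  refine end_ext' (A := s j * LinearMap.mulRight K g)
    (B := LinearMap.mulRight K (s j g) * s j) (fun η => ?_) f
  refine end_ext' (A := s j * LinearMap.mulLeft K (mono η))
    (B := LinearMap.mulLeft K (s j (mono η)) * s j) (fun ν => ?_) g
  simp only [Module.End.mul_apply, LinearMap.mulLeft_apply, mono_mul_mono, s, permVars, onMono_mono]
  rfl

theorem s_s (j : Fin n) (f : Laurent K n) : s j (s j f) = f := by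
  refine end_ext' (A := s j * s j) (B := 1) (fun η => ?_) f
  simp only [Module.End.mul_apply, s, permVars, onMono_mono, Module.End.one_apply]
  congr 1
  funext k
  simp

theorem s_X_left (j : Fin n) : (s j (X j.castSucc) : Laurent K n) = X j.succ := by
  simp only [s, permVars, onMono_mono, X]
  congr 1
  funext k
  simp [Pi.single_apply, Equiv.swap_apply_eq_iff]

theorem s_X_right (j : Fin n) : (s j (X j.succ) : Laurent K n) = X j.castSucc := by
  rw [← s_X_left, s_s]

theorem X_sub_X_ne_zero (j : Fin n) : (X j.castSucc - X j.succ : Laurent K n) ≠ 0 := by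
  have hne : j.castSucc ≠ j.succ := (Fin.castSucc_lt_succ (i := j)).ne
  intro h
  have h1 := congrArg (fun f : Laurent K n => f.coeff (Pi.single j.castSucc 1)) (sub_eq_zero.1 h)
  have h2 : (Pi.single j.succ 1 : Fin (n + 1) → ℤ) ≠ Pi.single j.castSucc 1 := fun h3 => by
    have := congrFun h3 j.succ
    simp [hne.symm] at this
  simp [X, mono, h2] at h1

theorem T_apply (t : K) (j : Fin n) (f : Laurent K n) :
    T t j f = t • f + (t • X j.castSucc - X j.succ) * divDiff j f := rfl

theorem s_divDiff (j : Fin n) (f : Laurent K n) : s j (divDiff j f) = divDiff j f := by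
  refine mul_left_cancel₀ (X_sub_X_ne_zero j) ?_
  have h := congrArg (s j) (sub_mul_divDiff j f)
  rw [s_mul, map_sub, map_sub, s_X_left, s_X_right, s_s] at h
  rw [sub_mul_divDiff]
  linear_combination -h

/-- The quadratic relation `(T_j - t) (T_j + 1) = 0`. -/
theorem T_mul_T (t : K) (j : Fin n) : T t j * T t j = (t - 1) • T t j + t • 1 := by
  refine LinearMap.ext fun f => mul_left_cancel₀ (X_sub_X_ne_zero j) ?_
  have h1 := sub_mul_divDiff j f
  have h2 := sub_mul_divDiff j (T t j f)
  rw [Module.End.mul_apply, T_apply t j (T t j f)]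
  rw [LinearMap.add_apply, LinearMap.smul_apply, LinearMap.smul_apply, Module.End.one_apply]
  generalize divDiff j (T t j f) = d at *
  rw [T_apply] at *
  rw [map_add, s_mul, map_sub, map_smul, map_smul, s_X_left, s_X_right, s_divDiff] at h2
  simp only [Algebra.smul_def, map_sub, map_one] at *
  linear_combination (algebraMap K (Laurent K n) t * X j.castSucc - X j.succ) * h2
    - (algebraMap K (Laurent K n) t * X j.castSucc - X j.succ) * algebraMap K (Laurent K n) t * h1

theorem T_mul_Tinv {t : K} (ht : t ≠ 0) (j : Fin n) : T t j * Tinv t j = 1 := by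
  rw [Tinv, mul_add, mul_smul_comm, mul_smul_comm, mul_one, T_mul_T, smul_add, smul_smul,
    smul_smul, inv_mul_cancel₀ ht, one_smul, ← add_assoc, ← add_smul]
  rw [show t⁻¹ - 1 + t⁻¹ * (t - 1) = 0 by field_simp; ring, zero_smul, zero_add]

theorem Tinv_mul_T {t : K} (ht : t ≠ 0) (j : Fin n) : Tinv t j * T t j = 1 := by
  rw [← T_mul_Tinv ht j, Tinv, mul_add, add_mul, smul_mul_assoc, mul_smul_comm, smul_mul_assoc,
    mul_smul_comm, one_mul, mul_one]

/-- `ω = s_{n} ⋯ s_2 s_1 τ_1` (in the numbering of `n + 1` variables from `1`): the rightmost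
factor acts first. -/
def omega (q : K) : Module.End K (Laurent K n) :=
  ((List.finRange n).reverse.map fun j => s j).prod * tau q 0

/-- The Cherednik operators. With `N = n + 1` variables numbered from `1` this is
`Y_i = t^{-N+i} T_i ⋯ T_{N-1} ω T_1⁻¹ ⋯ T_{i-1}⁻¹`; here the numbering starts at `0`. -/
def Y (q t : K) (i : Fin (n + 1)) : Module.End K (Laurent K n) :=
  t ^ ((i : ℤ) - n) •
    ((((List.finRange n).filter fun j : Fin n => i.val ≤ j.val).map (T t)).prod * omega q *
      (((List.finRange n).filter fun j : Fin n => j.val < i.val).map (Tinv t)).prod)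

end Operators

section Compositions

variable {n : ℕ}

/-- `η⁺`: the weakly decreasing rearrangement of `η`. -/
def plus (η : Fin (n + 1) → ℤ) : Fin (n + 1) → ℤ := fun i => η (Tuple.sort η i.rev)

/-- `-η` with its parts reversed: `(-η_n, …, -η_0)`. -/
def negRev (η : Fin (n + 1) → ℤ) : Fin (n + 1) → ℤ := fun i => -η i.rev

/-- Strict dominance `ν < η`: all partial sums of `ν` are at most those of `η`, and `ν ≠ η`. -/
def DomLT (ν η : Fin (n + 1) → ℤ) : Prop :=
  ν ≠ η ∧ ∀ p, ∑ i ∈ Finset.Iic p, ν i ≤ ∑ i ∈ Finset.Iic p, η i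

/-- The order `ν ≺ η` on compositions of the same modulus. -/
def Prec (ν η : Fin (n + 1) → ℤ) : Prop :=
  ∑ i, ν i = ∑ i, η i ∧ (DomLT (plus ν) (plus η) ∨ plus ν = plus η ∧ DomLT ν η)

/-- The leg colength `l'_η(i) = #{k < i | η_k ≥ η_i} + #{k > i | η_k > η_i}`. -/
def legColength (η : Fin (n + 1) → ℤ) (i : Fin (n + 1)) : ℕ :=
  (Finset.univ.filter fun k => k < i ∧ η i ≤ η k).card +
    (Finset.univ.filter fun k => i < k ∧ η i < η k).card

end Compositions

section Macdonald

variable {K : Type*} [Field K] {n : ℕ}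

/-- The defining properties of the non-symmetric Macdonald (Laurent) polynomial `E_η(x; q, t)`:
`f = x ^ η + ∑_{ν ≺ η} b_ν x ^ ν` and `Y_i f = q ^ {η_i} t ^ {-l'_η(i)} f` for all `i`. -/
def IsMacdonald (q t : K) (η : Fin (n + 1) → ℤ) (f : Laurent K n) : Prop :=
  f.coeff η = 1 ∧ (∀ ν, f.coeff ν ≠ 0 → ν = η ∨ Prec ν η) ∧
    ∀ i, Y q t i f = (q ^ η i * t ^ (-(legColength η i : ℤ))) • f

open Classical in
/-- The non-symmetric Macdonald Laurent polynomial `E_η(x; q, t)`: the Laurent polynomial with the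
defining properties `IsMacdonald`. -/
def E (q t : K) (η : Fin (n + 1) → ℤ) : Laurent K n :=
  if h : ∃ f, IsMacdonald q t η f then h.choose else 0

/-- The dual polynomial `Ê_η(x; q, t) = E_η(x_n, …, x_0; q⁻¹, t⁻¹)`. -/
def Ehat (q t : K) (η : Fin (n + 1) → ℤ) : Laurent K n := revVars (E q⁻¹ t⁻¹ η)

end Macdonald

end NonsymMacdonald

end

/-! Let `flipInv` be the substitution x_i ↦ 1/x_{n-i}. It carries T_j to T_{n-1-j} (`flipInv_T`) and
satisfies ω · flipInv · ω = flipInv (`omega_flipInv_omega`). The factors of the Cherednik operators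
therefore cancel in pairs around it, which leaves Y_{n-i} · flipInv · Y_i = t^{-n} · flipInv
(`Y_flipInv_Y`). So `flipInv` maps the joint eigenfunction of label η to a joint eigenfunction. Its
eigenvalues are those of label `negRev η`, because the leg colength of η at i and that of `negRev η`
at n-i add up to n (`legColength_negRev`). Since `negRev` preserves ≺ (`Prec.negRev`), the leading
term is right as well, and uniqueness identifies the image with E of `negRev η`. Undoing the
reversal of the variables gives the first identity; the second is the first at (q⁻¹, t⁻¹).

Existence and uniqueness rest on three facts. Each Y_i is triangular on monomials for ≺, with the
expected diagonal entries (`Y_mono`). Labels ν ≺ η have different joint eigenvalues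
(`exists_eigenvalue_ne`, from the combinatorial `eq_of_plus_le`). The Y_i commute (`Y_commute`), by
the braid relations and the way ω permutes the T_j. The first two give uniqueness by comparing
coefficients at a maximal exponent. For existence, different lower exponents may need different Y_i
to be separated from η, so x^η is hit with a product of factors Y_i - λ that annihilates everything
below η (`exists_annihilator`); commutativity makes the result a joint eigenfunction. -/

namespace NonsymMacdonald

/-! ### Combinatorics of the order ≺ and of leg colengths. -/

section Dominance

variable {n : ℕ}

theorem sum_Iic_zero (f : Fin (n + 1) → ℤ) : ∑ i ∈ Finset.Iic 0, f i = f 0 := by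
  rw [show Finset.Iic (0 : Fin (n + 1)) = {0} by ext i; simp, Finset.sum_singleton]

theorem sum_Iic_succ (f : Fin (n + 1) → ℤ) (j : Fin n) :
    ∑ i ∈ Finset.Iic j.succ, f i = ∑ i ∈ Finset.Iic j.castSucc, f i + f j.succ := by
  rw [show Finset.Iic j.succ = insert j.succ (Finset.Iic j.castSucc) by
    ext i; simp only [Finset.mem_Iic, Finset.mem_insert, Fin.ext_iff, Fin.le_def, Fin.val_succ,
      Fin.val_castSucc]; omega, Finset.sum_insert (by simp [Fin.le_def]), add_comm]

theorem sum_Iic_last (f : Fin (n + 1) → ℤ) :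
    ∑ i ∈ Finset.Iic (Fin.last n), f i = ∑ i, f i := by
  congr 1; ext i; simp [Fin.le_last]

theorem sum_Iic_rev (f : Fin (n + 1) → ℤ) (j : Fin n) :
    ∑ i ∈ Finset.Iic j.rev.castSucc, f i.rev = ∑ i, f i - ∑ i ∈ Finset.Iic j.castSucc, f i := by
  have h := Finset.sum_add_sum_compl (Finset.Iic j.castSucc) f
  rw [← h, add_sub_cancel_left]
  refine Finset.sum_bij (fun i _ => i.rev) (fun i hi => ?_) (fun i _ k _ h => Fin.rev_injective h)
    (fun k hk => ⟨k.rev, ?_, Fin.rev_rev k⟩) (fun _ _ => rfl)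
  · simp only [Finset.mem_Iic, Finset.mem_compl, Fin.le_def, Fin.val_castSucc, Fin.val_rev] at *
    omega
  · simp only [Finset.mem_Iic, Finset.mem_compl, Fin.le_def, Fin.val_castSucc, Fin.val_rev] at *
    omega

theorem eq_of_sum_Iic_eq {ν η : Fin (n + 1) → ℤ}
    (h : ∀ p, ∑ i ∈ Finset.Iic p, ν i = ∑ i ∈ Finset.Iic p, η i) : ν = η := by
  funext i
  refine Fin.cases ?_ (fun j => ?_) i
  · simpa only [sum_Iic_zero] using h 0
  · have h1 := h j.succ
    rw [sum_Iic_succ, sum_Iic_succ, h] at h1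
    exact add_left_cancel h1

theorem DomLT.trans {μ ν η : Fin (n + 1) → ℤ} (h : DomLT μ ν) (h' : DomLT ν η) : DomLT μ η := by
  refine ⟨fun e => ?_, fun p => (h.2 p).trans (h'.2 p)⟩
  subst e
  exact h.1 (eq_of_sum_Iic_eq fun p => le_antisymm (h.2 p) (h'.2 p))

theorem Prec.trans {μ ν η : Fin (n + 1) → ℤ} (h : Prec μ ν) (h' : Prec ν η) : Prec μ η := by
  refine ⟨h.1.trans h'.1, ?_⟩
  rcases h.2 with a | ⟨a, a'⟩ <;> rcases h'.2 with b | ⟨b, b'⟩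
  · exact Or.inl (a.trans b)
  · exact Or.inl (b ▸ a)
  · exact Or.inl (a ▸ b)
  · exact Or.inr ⟨a.trans b, a'.trans b'⟩

theorem Prec.irrefl (η : Fin (n + 1) → ℤ) : ¬ Prec η η := fun h =>
  h.2.elim (fun a => a.1 rfl) fun a => a.2.1 rfl

theorem Prec.plus_le {ν η : Fin (n + 1) → ℤ} (h : Prec ν η) (p : Fin (n + 1)) :
    ∑ i ∈ Finset.Iic p, plus ν i ≤ ∑ i ∈ Finset.Iic p, plus η i :=
  h.2.elim (fun a => a.2 p) fun a => by rw [a.1]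

theorem plus_eq_of_antitone {η : Fin (n + 1) → ℤ} (σ : Equiv.Perm (Fin (n + 1)))
    (h : Antitone (η ∘ σ)) : plus η = η ∘ σ := by
  have h1 : Monotone (η ∘ (Fin.revPerm.trans σ)) := fun i j hij => h (Fin.rev_le_rev.2 hij)
  have h2 := Tuple.comp_sort_eq_comp_iff_monotone.2 h1
  funext i
  have h3 := congrFun h2 i.rev
  simpa [plus] using h3.symm

theorem plus_antitone (η : Fin (n + 1) → ℤ) : Antitone (plus η) := fun _ _ hij =>
  Tuple.monotone_sort η (Fin.rev_le_rev.2 hij)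

theorem exists_plus_eq (η : Fin (n + 1) → ℤ) :
    ∃ σ : Equiv.Perm (Fin (n + 1)), plus η = η ∘ σ :=
  ⟨Fin.revPerm.trans (Tuple.sort η), rfl⟩

theorem plus_comp_perm (η : Fin (n + 1) → ℤ) (σ : Equiv.Perm (Fin (n + 1))) :
    plus (η ∘ σ) = plus η := by
  funext i
  exact congrFun (Tuple.comp_perm_comp_sort_eq_comp_sort (f := η) (σ := σ)) i.rev

theorem sum_plus_comp (η : Fin (n + 1) → ℤ) (g : ℤ → ℤ) : ∑ i, g (plus η i) = ∑ i, g (η i) := by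
  obtain ⟨σ, h⟩ := exists_plus_eq η
  rw [h]
  exact Equiv.sum_comp σ fun i => g (η i)

/-- After the common part is cancelled, the two remaining index sets have equal size, and the value
`f p` separates the values of `f` on them. -/
theorem sum_le_sum_Iic_of_antitone {f : Fin (n + 1) → ℤ} (hf : Antitone f) (p : Fin (n + 1))
    (S : Finset (Fin (n + 1))) (hS : S.card = p + 1) : ∑ i ∈ S, f i ≤ ∑ i ∈ Finset.Iic p, f i := by
  have hc : (S \ Finset.Iic p).card = (Finset.Iic p \ S).card := by
    apply Finset.card_sdiff_comm
    rw [hS, Fin.card_Iic]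
  rw [← Finset.sum_inter_add_sum_sdiff S (Finset.Iic p),
    ← Finset.sum_inter_add_sum_sdiff (Finset.Iic p) S,
    Finset.inter_comm]
  refine add_le_add_right ?_ _
  calc _ ≤ (S \ Finset.Iic p).card • f p := Finset.sum_le_card_nsmul _ _ _ fun i hi => hf ?_
    _ = (Finset.Iic p \ S).card • f p := by rw [hc]
    _ ≤ _ := Finset.card_nsmul_le_sum _ _ _ fun i hi => hf ?_
  · simp only [Finset.mem_sdiff, Finset.mem_Iic] at hi; exact (not_le.1 hi.2).le
  · simp only [Finset.mem_sdiff, Finset.mem_Iic] at hi; exact hi.1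

theorem sum_le_sum_plus (η : Fin (n + 1) → ℤ) (p : Fin (n + 1))
    (S : Finset (Fin (n + 1))) (hS : S.card = p + 1) :
    ∑ i ∈ S, η i ≤ ∑ i ∈ Finset.Iic p, plus η i := by
  obtain ⟨σ, h⟩ := exists_plus_eq η
  have h1 := sum_le_sum_Iic_of_antitone (plus_antitone η) p (S.map σ.symm.toEmbedding) (by simpa)
  simpa [h] using h1

/-- With `sum_le_sum_plus`, this makes a partial sum of η⁺ the maximum of η over sets of p+1
positions. Dominance can then be checked without sorting. -/
theorem exists_sum_eq_sum_plus (η : Fin (n + 1) → ℤ) (p : Fin (n + 1)) :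
    ∃ S : Finset (Fin (n + 1)), S.card = p + 1 ∧
      ∑ i ∈ S, η i = ∑ i ∈ Finset.Iic p, plus η i := by
  obtain ⟨σ, h⟩ := exists_plus_eq η
  exact ⟨(Finset.Iic p).map σ.toEmbedding, by simp, by simp [h]⟩

/-- The largest part of η bounds all parts of ν from above; the fixed total then bounds them from
below. -/
theorem finite_prec (η : Fin (n + 1) → ℤ) : {ν | Prec ν η}.Finite := by
  set M := plus η 0 with hM
  have hb : ∀ ν, Prec ν η → ∀ i, ν i ≤ M := fun ν h i => by
    have h1 := sum_le_sum_plus ν 0 {i} (by simp)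
    have h2 := h.plus_le 0
    rw [Finset.sum_singleton] at h1
    rw [sum_Iic_zero (plus η)] at h2
    exact h1.trans h2
  refine (Set.finite_Icc (fun _ => ∑ i, η i - n * M) (fun _ => M)).subset
    fun ν h => ⟨fun i => ?_, fun i => hb ν h i⟩
  have h1 := Finset.sum_erase_add Finset.univ ν (Finset.mem_univ i)
  have h2 := Finset.sum_le_card_nsmul (Finset.univ.erase i) ν M fun k _ => hb ν h k
  rw [Finset.card_erase_of_mem (Finset.mem_univ i), Finset.card_univ, Fintype.card_fin,
    Nat.add_sub_cancel, nsmul_eq_mul] at h2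
  have h3 := h.1
  simp only
  linarith

theorem negRev_negRev (η : Fin (n + 1) → ℤ) : negRev (negRev η) = η := by
  funext i; simp [negRev]

theorem plus_negRev (η : Fin (n + 1) → ℤ) : plus (negRev η) = negRev (plus η) := by
  obtain ⟨σ, h⟩ := exists_plus_eq η
  have h1 : negRev η ∘ ((Fin.revPerm.trans σ).trans Fin.revPerm) = negRev (plus η) := by
    funext i; simp [negRev, h]
  rw [← h1]
  refine plus_eq_of_antitone _ ?_
  rw [h1]
  exact fun i j hij => neg_le_neg (plus_antitone η (Fin.rev_le_rev.2 hij))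

theorem sum_negRev (η : Fin (n + 1) → ℤ) : ∑ i, negRev η i = - ∑ i, η i := by
  simp only [negRev, Finset.sum_neg_distrib]
  exact congrArg _ (Equiv.sum_comp Fin.revPerm η)

/-- A partial sum of `negRev η` is a partial sum of η minus the total, so equal totals are what
keeps the inequalities. -/
theorem DomLT.negRev {ν η : Fin (n + 1) → ℤ} (hs : ∑ i, ν i = ∑ i, η i) (h : DomLT ν η) :
    DomLT (negRev ν) (negRev η) := by
  refine ⟨fun e => h.1 (by rw [← negRev_negRev ν, e, negRev_negRev]), fun p => ?_⟩
  refine Fin.lastCases ?_ (fun j => ?_) p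
  · rw [sum_Iic_last, sum_Iic_last, sum_negRev, sum_negRev, hs]
  · simp only [NonsymMacdonald.negRev, Finset.sum_neg_distrib]
    have h1 := sum_Iic_rev ν j.rev
    have h2 := sum_Iic_rev η j.rev
    have h3 := h.2 j.rev.castSucc
    rw [Fin.rev_rev] at h1 h2
    linarith

theorem Prec.negRev {ν η : Fin (n + 1) → ℤ} (h : Prec ν η) :
    Prec (negRev ν) (negRev η) := by
  refine ⟨by rw [sum_negRev, sum_negRev, h.1], ?_⟩
  rw [plus_negRev, plus_negRev]
  rcases h.2 with a | ⟨a, b⟩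
  · refine Or.inl (a.negRev ?_)
    simpa only [sum_plus_comp _ fun x => x] using h.1
  · exact Or.inr ⟨by rw [a], b.negRev h.1⟩

/-- The order in which `legColength` counts the positions: by decreasing parts, and from left to
right among equal parts. -/
def Before (η : Fin (n + 1) → ℤ) (k i : Fin (n + 1)) : Prop :=
  η i < η k ∨ η i = η k ∧ k < i

instance (η : Fin (n + 1) → ℤ) (k i : Fin (n + 1)) : Decidable (Before η k i) :=
  inferInstanceAs (Decidable (_ ∨ _))

/-- The leg colength is thus the rank of a position in a linear order, hence a bijection onto 0, …,
n that sorts η. -/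
theorem legColength_eq_card (η : Fin (n + 1) → ℤ) (i : Fin (n + 1)) :
    legColength η i = (Finset.univ.filter fun k => Before η k i).card := by
  rw [legColength, ← Finset.card_union_of_disjoint]
  · congr 1
    ext k
    simp only [Finset.mem_union, Finset.mem_filter, Finset.mem_univ, true_and]
    unfold Before
    rcases lt_trichotomy k i with h | rfl | h
    · simp [h, h.not_gt, le_iff_lt_or_eq]
    · simp
    · simp [h, h.not_gt]
  · rw [Finset.disjoint_filter]
    exact fun k _ h h' => h.1.not_gt h'.1

theorem legColength_lt_legColength {η : Fin (n + 1) → ℤ} {k i : Fin (n + 1)}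
    (h : Before η k i) : legColength η k < legColength η i := by
  rw [legColength_eq_card, legColength_eq_card]
  refine Finset.card_lt_card (Finset.ssubset_iff_of_subset (fun l hl => ?_) |>.2 ⟨k, ?_, ?_⟩)
  · simp only [Finset.mem_filter, Finset.mem_univ, true_and] at *
    unfold Before at *
    omega
  · simpa using h
  · simp only [Finset.mem_filter, Finset.mem_univ, true_and]
    unfold Before
    omega

theorem legColength_injective (η : Fin (n + 1) → ℤ) : Function.Injective (legColength η) := by
  intro i k h
  by_contra hne
  have : Before η k i ∨ Before η i k := by
    simp only [Before]; omega
  rcases this with h' | h'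
  · exact (legColength_lt_legColength h').ne' h
  · exact (legColength_lt_legColength h').ne h

theorem legColength_lt (η : Fin (n + 1) → ℤ) (i : Fin (n + 1)) : legColength η i < n + 1 := by
  rw [legColength_eq_card]
  have : (Finset.univ.filter fun k => Before η k i) ⊆ Finset.univ.erase i := fun k hk => by
    simp only [Finset.mem_filter, Finset.mem_univ, true_and, Finset.mem_erase, and_true] at *
    rintro rfl
    simp [Before] at hk
  have := Finset.card_le_card this
  rw [Finset.card_erase_of_mem (Finset.mem_univ i), Finset.card_univ, Fintype.card_fin] at this
  omega

/-- `legColength η` as a permutation of the positions. -/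
noncomputable def rankPerm (η : Fin (n + 1) → ℤ) : Equiv.Perm (Fin (n + 1)) :=
  Equiv.ofBijective (fun i => ⟨legColength η i, legColength_lt η i⟩)
    (Finite.injective_iff_bijective.1 fun _ _ h => legColength_injective η (Fin.ext_iff.1 h))

theorem val_rankPerm (η : Fin (n + 1) → ℤ) (i : Fin (n + 1)) :
    (rankPerm η i : ℕ) = legColength η i := rfl

theorem plus_eq_comp_rankPerm_symm (η : Fin (n + 1) → ℤ) : plus η = η ∘ (rankPerm η).symm := by
  refine plus_eq_of_antitone _ fun a b hab => not_lt.1 fun h => ?_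
  have := legColength_lt_legColength (Or.inl h : Before η _ _)
  rw [← val_rankPerm, ← val_rankPerm, Equiv.apply_symm_apply, Equiv.apply_symm_apply] at this
  exact this.not_ge hab

/-- Negating and reversing turns the linear order `Before` around, so the two counts together run
over all positions other than i. -/
theorem legColength_negRev (η : Fin (n + 1) → ℤ) (i : Fin (n + 1)) :
    legColength (negRev η) i.rev + legColength η i = n := by
  rw [legColength_eq_card, legColength_eq_card]
  have h1 : (Finset.univ.filter fun k => Before (negRev η) k i.rev).card =
      (Finset.univ.filter fun k => Before η i k).card := by
    refine Finset.card_equiv Fin.revPerm fun k => ?_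
    simp only [Finset.mem_filter, Finset.mem_univ, true_and, Fin.revPerm_apply]
    simp only [Before, negRev, Fin.rev_rev, neg_lt_neg_iff, neg_inj]
    rw [Fin.lt_rev_iff]
    simp only [eq_comm]
  rw [h1, ← Finset.card_union_of_disjoint]
  · have : (Finset.univ.filter fun k => Before η i k) ∪ (Finset.univ.filter fun k => Before η k i) =
        Finset.univ.erase i := by
      ext k
      simp only [Finset.mem_union, Finset.mem_filter, Finset.mem_univ, true_and,
        Finset.mem_erase, and_true]
      rcases eq_or_ne k i with rfl | hne
      · simp [Before]
      · simp only [hne, ne_eq, not_false_eq_true, iff_true]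
        unfold Before
        omega
    rw [this, Finset.card_erase_of_mem (Finset.mem_univ i), Finset.card_univ, Fintype.card_fin]
    rfl
  · rw [Finset.disjoint_filter]
    intro k _
    simp only [Before]
    omega

/-- Compositions are separated by parts and leg colengths, under a sign condition which forbids
that both grow together. -/
theorem eq_of_plus_le {ν η : Fin (n + 1) → ℤ}
    (hp : ∀ p, ∑ i ∈ Finset.Iic p, plus ν i ≤ ∑ i ∈ Finset.Iic p, plus η i)
    (h : ∀ i, legColength η i < legColength ν i → η i < ν i)
    (h' : ∀ i, legColength η i = legColength ν i → η i = ν i) : ν = η := by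
  suffices hr : ∀ r i, legColength η i = r → legColength ν i = r by
    funext i
    exact (h' i (hr _ i rfl).symm).symm
  intro r
  induction r using Nat.strong_induction_on with
  | _ r ih =>
    intro i hi
    by_contra hne
    -- A rank below r in ν is already taken: by induction it belongs to the position having that
    -- rank in η.
    have hlt : r < legColength ν i := by
      refine lt_of_le_of_ne (not_lt.1 fun hlt => ?_) (Ne.symm hne)
      let k := (rankPerm η).symm (rankPerm ν i)
      have hk : legColength η k = legColength ν i := by
        rw [← val_rankPerm, ← val_rankPerm, Equiv.apply_symm_apply]
      have h2 := ih _ hlt k hk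
      have h3 := legColength_injective ν h2
      rw [h3] at hk
      omega
    have hνi := h i (hi ▸ hlt)
    have hb : ∀ k, legColength η k < r → ν k = η k := fun k hk => (h' k (ih _ hk k rfl).symm).symm
    -- The positions of η-rank at most r realise a partial sum of η⁺. On them ν agrees with η except
    -- at i, where it is larger, against the dominance of η⁺ over ν⁺.
    set S := (Finset.Iic (rankPerm η i)).map (rankPerm η).symm.toEmbedding with hS
    have hSi : i ∈ S := by simp [hS]
    have h1 := sum_le_sum_plus ν (rankPerm η i) S (by simp [hS])
    have h2 : ∑ i ∈ Finset.Iic (rankPerm η i), plus η i = ∑ k ∈ S, η k := by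
      rw [plus_eq_comp_rankPerm_symm]
      simp [hS]
    have h3 : ∑ k ∈ S, η k < ∑ k ∈ S, ν k := by
      refine Finset.sum_lt_sum (fun k hk => ?_) ⟨i, hSi, hνi⟩
      by_cases hki : k = i
      · rw [hki]; exact hνi.le
      · refine (hb k ?_).ge
        have h4 : rankPerm η k ≤ rankPerm η i := by simpa [hS] using hk
        have h5 : rankPerm η k ≠ rankPerm η i := fun e => hki ((rankPerm η).injective e)
        have := lt_of_le_of_ne h4 h5
        rw [Fin.lt_def, val_rankPerm, val_rankPerm, hi] at this
        exact this
    have := hp (rankPerm η i)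
    omega

end Dominance

/-! ### Intertwining principles and braid relations for the T_j. -/

section Intertwining

variable {K : Type*} [Field K] {n : ℕ}

theorem s_mono_comp (j : Fin n) (η : Fin (n + 1) → ℤ) :
    (s j (mono η) : Laurent K n) = mono (η ∘ Equiv.swap j.castSucc j.succ) := by
  rw [s, permVars, onMono_mono, Equiv.symm_swap]

theorem map_mul_of_mono {A : Module.End K (Laurent K n)}
    (h : ∀ η ν, A (mono (η + ν)) = A (mono η) * A (mono ν)) (f g : Laurent K n) :
    A (f * g) = A f * A g := by
  refine end_ext' (A := A * LinearMap.mulRight K g)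
    (B := LinearMap.mulRight K (A g) * A) (fun η => ?_) f
  refine end_ext' (A := A * LinearMap.mulLeft K (mono η))
    (B := LinearMap.mulLeft K (A (mono η)) * A) (fun ν => ?_) g
  simp only [Module.End.mul_apply, LinearMap.mulLeft_apply, mono_mul_mono, h]

theorem map_s_of_mono {A : Module.End K (Laurent K n)} {j k : Fin n}
    (h : ∀ η, A (s j (mono η)) = s k (A (mono η))) (f : Laurent K n) : A (s j f) = s k (A f) :=
  end_ext' (A := A * s j) (B := s k * A) h f

/-- A multiplicative operator which intertwines `s_j` and `s_k` and sends `x_j`, `x_{j+1}` to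
common multiples of `x_k`, `x_{k+1}` intertwines `T_j` and `T_k`. -/
theorem map_T {A : Module.End K (Laurent K n)} (hA : ∀ f g, A (f * g) = A f * A g)
    {j k : Fin n} (u : Laurent K n) (h1 : A (X j.castSucc) = u * X k.castSucc)
    (h2 : A (X j.succ) = u * X k.succ) (hs : ∀ f, A (s j f) = s k (A f)) (t : K)
    (f : Laurent K n) : A (T t j f) = T t k (A f) := by
  -- The common multiple u scales the denominator of the divided difference; the numerator t x_j -
  -- x_{j+1} scales by the same u, so the ratio is unaffected.
  have h3 : u * A (divDiff j f) = divDiff k (A f) := by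
    refine mul_left_cancel₀ (X_sub_X_ne_zero k) ?_
    rw [sub_mul_divDiff, ← hs, ← map_sub, ← sub_mul_divDiff j f, hA, map_sub, h1, h2]
    ring
  rw [T_apply, T_apply, map_add, map_smul, hA, map_sub, map_smul, h1, h2, ← h3]
  simp only [Algebra.smul_def]
  ring

/-- The operator with its denominator cleared and no divided difference left, so that identities
between products of T_j become polynomial identities. -/
theorem sub_mul_T (t : K) (j : Fin n) (f : Laurent K n) :
    (X j.castSucc - X j.succ) * T t j f = (1 - algebraMap K _ t) * (X j.succ * f)
      + (algebraMap K _ t * X j.castSucc - X j.succ) * s j f := by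
  rw [T_apply]
  have h := sub_mul_divDiff j f
  simp only [Algebra.smul_def]
  linear_combination (algebraMap K (Laurent K n) t * X j.castSucc - X j.succ) * h

theorem s_X_of_ne {j : Fin n} {i : Fin (n + 1)} (h1 : i ≠ j.castSucc) (h2 : i ≠ j.succ) :
    (s j (X i) : Laurent K n) = X i := by
  rw [X, s_mono_comp]
  congr 1
  funext k
  simp [Pi.single_apply, Equiv.swap_apply_eq_iff, Equiv.swap_apply_of_ne_of_ne h1 h2]

theorem divDiff_mul_of_s_eq {j : Fin n} {g : Laurent K n} (h : s j g = g) (f : Laurent K n) :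
    divDiff j (g * f) = g * divDiff j f := by
  refine mul_left_cancel₀ (X_sub_X_ne_zero j) ?_
  rw [mul_left_comm, sub_mul_divDiff, sub_mul_divDiff, s_mul, h, mul_sub]

theorem T_mul_of_s_eq {j : Fin n} {g : Laurent K n} (h : s j g = g) (t : K) (f : Laurent K n) :
    T t j (g * f) = g * T t j f := by
  rw [T_apply, T_apply, divDiff_mul_of_s_eq h, mul_add, mul_smul_comm, mul_left_comm]

/-- The two operators involve disjoint pairs of variables: T_j commutes with s_i and with
multiplication by x_i and x_{i+1}, hence with the divided difference defining T_i. -/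
theorem T_commute_far (t : K) {i j : Fin n} (h : (i : ℕ) + 1 < j) : Commute (T t i) (T t j) := by
  have hi1 : (s j (X i.castSucc) : Laurent K n) = X i.castSucc :=
    s_X_of_ne (by simp [Fin.ext_iff]; omega) (by simp [Fin.ext_iff]; omega)
  have hi2 : (s j (X i.succ) : Laurent K n) = X i.succ :=
    s_X_of_ne (by simp [Fin.ext_iff]; omega) (by simp [Fin.ext_iff]; omega)
  have hj1 : (s i (X j.castSucc) : Laurent K n) = X j.castSucc :=
    s_X_of_ne (by simp [Fin.ext_iff]; omega) (by simp [Fin.ext_iff]; omega)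
  have hj2 : (s i (X j.succ) : Laurent K n) = X j.succ :=
    s_X_of_ne (by simp [Fin.ext_iff]; omega) (by simp [Fin.ext_iff]; omega)
  have hs : ∀ f : Laurent K n, s i (s j f) = s j (s i f) := by
    refine map_s_of_mono fun η => ?_
    rw [s_mono_comp, s_mono_comp, s_mono_comp, s_mono_comp]
    congr 1
    have hd : Equiv.Perm.Disjoint (Equiv.swap i.castSucc i.succ)
        (Equiv.swap j.castSucc j.succ) := by
      intro k
      by_cases h1 : k = i.castSucc ∨ k = i.succ
      · right
        refine Equiv.swap_apply_of_ne_of_ne ?_ ?_ <;>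
        · rintro rfl
          simp [Fin.ext_iff] at h1
          omega
      · left
        exact Equiv.swap_apply_of_ne_of_ne (fun e => h1 (Or.inl e)) (fun e => h1 (Or.inr e))
    funext k
    exact congrArg η (congrArg (fun σ : Equiv.Perm _ => σ k) hd.commute.eq).symm
  have hsT : ∀ f : Laurent K n, s i (T t j f) = T t j (s i f) :=
    map_T (s_mul i) 1 (by rw [one_mul, hj1]) (by rw [one_mul, hj2]) hs t
  have hd : ∀ f : Laurent K n, divDiff i (T t j f) = T t j (divDiff i f) := fun f => by
    refine mul_left_cancel₀ (X_sub_X_ne_zero i) ?_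
    rw [← T_mul_of_s_eq (by rw [map_sub, hi1, hi2]), sub_mul_divDiff, sub_mul_divDiff, map_sub, hsT]
  refine LinearMap.ext fun f => ?_
  rw [Module.End.mul_apply, Module.End.mul_apply, T_apply t i, T_apply t i, map_add, map_smul,
    T_mul_of_s_eq (by rw [map_sub, map_smul, hi1, hi2]), hd]

/-- Here a, b, c are three consecutive variables, the f's are the images of one element under the
symmetric group, and the g's and h's are the successive stages of the two sides of the braid
relation with their transforms. All relations are instances of `sub_mul_T`; they determine both ends
as the same combination of the f's once denominators are cleared. -/
theorem braid_of_relations {R : Type*} [CommRing R] [IsDomain R]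
    {t a b c f f1 f2 f12 f21 f121 g1 g2 g3 h1 h2 h3 g11 g12 g112 g21 h11 h12 h112 h22 : R}
    (hab : a - b ≠ 0) (hbc : b - c ≠ 0) (hac : a - c ≠ 0)
    (e1 : (a - b) * g1 = (1 - t) * (b * f) + (t * a - b) * f1)
    (e2 : (b - a) * g11 = (1 - t) * (a * f1) + (t * b - a) * f)
    (e3 : (a - c) * g12 = (1 - t) * (c * f2) + (t * a - c) * f21)
    (e4 : (b - c) * g112 = (1 - t) * (c * f12) + (t * b - c) * f121)
    (e5 : (b - c) * g2 = (1 - t) * (c * g1) + (t * b - c) * g12)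
    (e6 : (a - c) * g21 = (1 - t) * (c * g11) + (t * a - c) * g112)
    (e7 : (a - b) * g3 = (1 - t) * (b * g2) + (t * a - b) * g21)
    (d1 : (b - c) * h1 = (1 - t) * (c * f) + (t * b - c) * f2)
    (d2 : (c - b) * h12 = (1 - t) * (b * f2) + (t * c - b) * f)
    (d3 : (a - c) * h11 = (1 - t) * (c * f1) + (t * a - c) * f12)
    (d4 : (a - b) * h112 = (1 - t) * (b * f21) + (t * a - b) * f121)
    (d5 : (a - b) * h2 = (1 - t) * (b * h1) + (t * a - b) * h11)
    (d6 : (a - c) * h22 = (1 - t) * (c * h12) + (t * a - c) * h112)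
    (d7 : (b - c) * h3 = (1 - t) * (c * h2) + (t * b - c) * h22) : g3 = h3 := by
  have hD : (a - b) ^ 2 * (b - c) ^ 2 * (a - c) ≠ 0 :=
    mul_ne_zero (mul_ne_zero (pow_ne_zero 2 hab) (pow_ne_zero 2 hbc)) hac
  refine mul_left_cancel₀ hD ?_
  linear_combination (a - b) * (b - c) ^ 2 * (a - c) * e7
    + (1 - t) * b * (a - b) * (b - c) * (a - c) * e5
    + (1 - t) ^ 2 * b * c * (b - c) * (a - c) * e1
    + (1 - t) * b * (t * b - c) * (a - b) * (b - c) * e3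
    + (t * a - b) * (a - b) * (b - c) ^ 2 * e6
    - (t * a - b) * (b - c) ^ 2 * (1 - t) * c * e2
    + (t * a - b) * (t * a - c) * (a - b) * (b - c) * e4
    - (a - b) ^ 2 * (b - c) * (a - c) * d7
    - (1 - t) * c * (a - b) * (b - c) * (a - c) * d5
    - (1 - t) ^ 2 * b * c * (a - b) * (a - c) * d1
    - (1 - t) * c * (t * a - b) * (a - b) * (b - c) * d3
    - (t * b - c) * (a - b) ^ 2 * (b - c) * d6
    + (t * b - c) * (a - b) ^ 2 * (1 - t) * c * d2
    - (t * b - c) * (t * a - c) * (a - b) * (b - c) * d4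

theorem X_injective : Function.Injective (X : Fin (n + 1) → Laurent K n) := by
  intro a b h
  by_contra hne
  have h1 := congrArg (fun f : Laurent K n => f.coeff (Pi.single a 1)) h
  have h2 : (Pi.single b 1 : Fin (n + 1) → ℤ) ≠ Pi.single a 1 := fun h3 => by
    have := congrFun h3 b
    simp [Ne.symm hne] at this
  simp [X, mono, h2] at h1

theorem s_algebraMap (j : Fin n) (r : K) : s j (algebraMap K (Laurent K n) r) = algebraMap K _ r := by
  have h : (s j 1 : Laurent K n) = 1 := by
    have := s_mono_comp (K := K) j 0
    simpa [mono, AddMonoidAlgebra.one_def] using this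
  rw [Algebra.algebraMap_eq_smul_one, map_smul, h]

theorem T_braid (t : K) {j k : Fin n} (h : (k : ℕ) = j + 1) :
    T t j * T t k * T t j = T t k * T t j * T t k := by
  have hk : k.castSucc = j.succ := by ext; simp [h]
  have hjk : j.castSucc ≠ k.succ := by simp [Fin.ext_iff, h]; omega
  have hjj : j.castSucc ≠ j.succ := (Fin.castSucc_lt_succ (i := j)).ne
  have hkk : k.succ ≠ j.succ := by simp [Fin.ext_iff, h]
  have ha : (s k (X j.castSucc) : Laurent K n) = X j.castSucc := s_X_of_ne (hk ▸ hjj) hjk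
  have hb : (s k (X j.succ) : Laurent K n) = X k.succ := by rw [← hk, s_X_left]
  have hb' : (s k (X k.succ) : Laurent K n) = X j.succ := by rw [← hk, s_X_right]
  have hc : (s j (X k.succ) : Laurent K n) = X k.succ := s_X_of_ne hjk.symm hkk
  have hs : ∀ f : Laurent K n, s j (s k (s j f)) = s k (s j (s k f)) := by
    refine end_ext' (K := K) (A := s j * s k * s j) (B := s k * s j * s k) fun η => ?_
    simp only [Module.End.mul_apply, s_mono_comp]
    congr 1
    have h1 := Equiv.swap_mul_swap_mul_swap hjj hjk
    have h2 := Equiv.swap_mul_swap_mul_swap hkk hjk.symm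
    rw [Equiv.swap_comm k.succ, Equiv.swap_comm _ j.castSucc, Equiv.swap_comm j.castSucc k.succ,
      ← h1] at h2
    rw [← hk] at *
    funext i
    exact congrArg η (congrArg (fun σ : Equiv.Perm _ => σ i) h2)
  refine LinearMap.ext fun f => ?_
  have e := fun g : Laurent K n => sub_mul_T t j g
  have d := fun g : Laurent K n => sub_mul_T t k g
  rw [hk] at d
  have es := fun g : Laurent K n => congrArg (s k) (e g)
  have ds := fun g : Laurent K n => congrArg (s j) (d g)
  have ess := fun g : Laurent K n => congrArg (s j) (es g)
  have dss := fun g : Laurent K n => congrArg (s k) (ds g)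
  have e' := fun g : Laurent K n => congrArg (s j) (e g)
  have d' := fun g : Laurent K n => congrArg (s k) (d g)
  simp only [s_mul, map_sub, map_add, s_algebraMap, ha, hb, hb', hc, s_X_left, s_X_right,
    sub_mul, one_mul, s_s] at es ds ess dss e' d'
  refine braid_of_relations (t := algebraMap K _ t) (sub_ne_zero.2 ((X_injective (K := K)).ne hjj))
    (sub_ne_zero.2 ((X_injective (K := K)).ne hkk.symm)) (sub_ne_zero.2 ((X_injective (K := K)).ne hjk))
    (e f) (f2 := s k f) (f21 := s k (s j f)) (f12 := s j (s k f)) (f121 := s j (s k (s j f)))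
    (g12 := s k (T t j f)) (g11 := s j (T t j f)) (g112 := s j (s k (T t j f))) ?_ ?_ ?_ (d _)
    (g21 := s j (T t k (T t j f))) ?_ (e _) (d f) (h12 := s k (T t k f)) (h11 := s j (T t k f))
    (h112 := s k (s j (T t k f))) ?_ ?_ ?_ (e _) (h22 := s k (T t j (T t k f))) ?_ (d _)
  · linear_combination e' f
  · linear_combination es f
  · linear_combination ess f
  · linear_combination ds (T t j f)
  · linear_combination d' f
  · linear_combination ds f
  -- The braid relation for the s_j is needed here, since the longest element arises from its other
  -- reduced word.
  · rw [hs]; linear_combination dss f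
  · linear_combination es (T t k f)

end Intertwining

/-! ### The factors of Y_i, the action of ω, and the flip of variables. -/

section Cherednik

variable {K : Type*} [Field K] {n : ℕ}

theorem finRange_filter_castSucc_le (j : Fin n) :
    (List.finRange n).filter (fun k : Fin n => j.castSucc.val ≤ k.val) =
      j :: (List.finRange n).filter fun k : Fin n => j.succ.val ≤ k.val := by
  refine List.Pairwise.eq_of_mem_iff (r := (· < ·)) ((List.pairwise_lt_finRange n).filter _)
    (List.pairwise_cons.2 ⟨fun k hk => ?_, (List.pairwise_lt_finRange n).filter _⟩) fun k => ?_
  · simp only [List.mem_filter, decide_eq_true_eq, Fin.val_succ] at hk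
    exact Fin.lt_def.2 (Nat.lt_of_succ_le hk.2)
  · simp [Fin.ext_iff]
    omega

theorem finRange_filter_lt_succ (j : Fin n) :
    (List.finRange n).filter (fun k : Fin n => k.val < j.succ.val) =
      (List.finRange n).filter (fun k : Fin n => k.val < j.castSucc.val) ++ [j] := by
  refine List.Pairwise.eq_of_mem_iff (r := (· < ·)) ((List.pairwise_lt_finRange n).filter _)
    (List.pairwise_append.2 ⟨(List.pairwise_lt_finRange n).filter _, List.pairwise_singleton _ _,
      fun k hk l hl => ?_⟩) fun k => ?_
  · simp only [List.mem_filter, decide_eq_true_eq, Fin.val_castSucc, List.mem_singleton] at hk hl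
    rw [hl]
    exact Fin.lt_def.2 hk.2
  · simp [Fin.ext_iff]
    omega

/-- `T_i ⋯ T_{n-1}`, the part of `Y_i` to the left of `ω`. -/
noncomputable def leftProd (t : K) (i : Fin (n + 1)) : Module.End K (Laurent K n) :=
  (((List.finRange n).filter fun j : Fin n => i.val ≤ j.val).map (T t)).prod

/-- `T_0⁻¹ ⋯ T_{i-1}⁻¹`, the part of `Y_i` to the right of `ω`. -/
noncomputable def rightProd (t : K) (i : Fin (n + 1)) : Module.End K (Laurent K n) :=
  (((List.finRange n).filter fun j : Fin n => j.val < i.val).map (Tinv t)).prod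

theorem Y_eq (q t : K) (i : Fin (n + 1)) :
    (Y q t i : Module.End K (Laurent K n)) =
      t ^ ((i : ℤ) - n) • (leftProd t i * omega q * rightProd t i) := rfl

theorem leftProd_last (t : K) : (leftProd t (Fin.last n) : Module.End K (Laurent K n)) = 1 := by
  rw [leftProd, List.filter_eq_nil_iff.2 (by simp), List.map_nil, List.prod_nil]

theorem leftProd_castSucc (t : K) (j : Fin n) :
    leftProd t j.castSucc = T t j * leftProd t j.succ := by
  rw [leftProd, finRange_filter_castSucc_le, List.map_cons, List.prod_cons, leftProd]

theorem rightProd_zero (t : K) : (rightProd t 0 : Module.End K (Laurent K n)) = 1 := by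
  rw [rightProd, List.filter_eq_nil_iff.2 (by simp), List.map_nil, List.prod_nil]

theorem rightProd_succ (t : K) (j : Fin n) :
    rightProd t j.succ = rightProd t j.castSucc * Tinv t j := by
  rw [rightProd, finRange_filter_lt_succ, List.map_append, List.prod_append, List.map_singleton,
    List.prod_singleton, rightProd]

theorem finRotate_castSucc (j : Fin n) : finRotate (n + 1) j.castSucc = j.succ := by
  ext
  rw [coe_finRotate_of_ne_last (Fin.castSucc_lt_last j).ne]
  simp

theorem swap_succAbove (j k : Fin n) :
    Equiv.swap j.castSucc j.succ (j.castSucc.succAbove k) = j.succ.succAbove k := by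
  rcases lt_trichotomy k j with h | rfl | h
  · rw [Fin.succAbove_of_castSucc_lt j.castSucc k (by simpa),
      Equiv.swap_apply_of_ne_of_ne (by simp [h.ne]) (by simp [Fin.ext_iff]; omega),
      Fin.succAbove_of_castSucc_lt _ _ (Fin.lt_def.2 (by simp; omega))]
  · rw [Fin.succAbove_succ_self, Fin.succAbove_castSucc_self, Equiv.swap_apply_right]
  · rw [Fin.succAbove_of_le_castSucc j.castSucc k (by simpa using h.le),
      Equiv.swap_apply_of_ne_of_ne (by simp [Fin.ext_iff]; omega) (by simp [h.ne']),
      Fin.succAbove_of_lt_succ _ _ (by simpa)]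

theorem removeNth_comp_swap (j : Fin n) (η : Fin (n + 1) → ℤ) :
    j.castSucc.removeNth (η ∘ Equiv.swap j.castSucc j.succ) = j.succ.removeNth η :=
  funext fun k => congrArg η (swap_succAbove j k)

/-- `ω` moves the first exponent to the end. -/
theorem omega_mono (q : K) (η : Fin (n + 1) → ℤ) :
    omega q (mono η) = q ^ η 0 • mono (η ∘ finRotate (n + 1)) := by
  -- Induction over the partial products s_{i-1} ⋯ s_0, which carry the first exponent to position i
  -- and keep the order of the others.
  have h : ∀ i : Fin (n + 1), ((((List.finRange n).filter
      fun j : Fin n => j.val < i.val).reverse.map fun j => s j).prod (mono η) : Laurent K n) =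
        mono (Fin.insertNth (α := fun _ => ℤ) i (η 0) (Fin.tail η)) := by
    intro i
    refine Fin.induction ?_ (fun j ih => ?_) i
    · rw [List.filter_eq_nil_iff.2 (by simp)]
      simp
    · rw [finRange_filter_lt_succ, List.reverse_append, List.reverse_singleton, List.singleton_append,
        List.map_cons, List.prod_cons, Module.End.mul_apply, ih, s_mono_comp]
      congr 1
      rw [Fin.eq_insertNth_iff]
      refine ⟨by simp, funext fun k => ?_⟩
      rw [Fin.removeNth, Function.comp_apply, ← swap_succAbove, Equiv.swap_apply_self,
        Fin.insertNth_apply_succAbove]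
  have h1 := h (Fin.last n)
  rw [List.filter_eq_self.2 (by simp)] at h1
  rw [omega, Module.End.mul_apply, tau, onMono_mono, map_smul, h1]
  congr 2
  rw [Fin.insertNth_eq_iff]
  refine ⟨by simp, funext fun k => ?_⟩
  rw [Fin.removeNth, Fin.succAbove_last, Function.comp_apply, finRotate_castSucc, Fin.tail]

theorem omega_mul {q : K} (hq : q ≠ 0) (f g : Laurent K n) :
    omega q (f * g) = omega q f * omega q g := by
  refine map_mul_of_mono (fun η ν => ?_) f g
  rw [omega_mono, omega_mono, omega_mono, smul_mul_smul_comm, mono_mul_mono, ← zpow_add₀ hq]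
  rfl

theorem omega_X_succ (q : K) (j : Fin n) : omega q (X j.succ) = X j.castSucc := by
  rw [X, omega_mono]
  have h : (Pi.single j.succ 1 : Fin (n + 1) → ℤ) ∘ finRotate (n + 1) = Pi.single j.castSucc 1 := by
    funext k
    simp only [Function.comp_apply, Pi.single_apply, ← finRotate_castSucc,
      EmbeddingLike.apply_eq_iff_eq]
  rw [h, Pi.single_eq_of_ne (Fin.succ_ne_zero j).symm, zpow_zero, one_smul, X]

theorem omega_X_zero (q : K) : (omega q (X 0) : Laurent K n) = q • X (Fin.last n) := by
  rw [X, omega_mono]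
  have h : (Pi.single 0 1 : Fin (n + 1) → ℤ) ∘ finRotate (n + 1) = Pi.single (Fin.last n) 1 := by
    funext k
    simp only [Function.comp_apply, Pi.single_apply, ← finRotate_last (n := n),
      EmbeddingLike.apply_eq_iff_eq]
  rw [h, Pi.single_eq_same, zpow_one, X]

/-- Away from x_0 the operator ω only lowers the index of a variable by one, so no power of q
appears. -/
theorem omega_T {q : K} (hq : q ≠ 0) (t : K) {j k : Fin n} (h : (k : ℕ) = j + 1) :
    omega q * T t k = T t j * omega q := by
  have hk : k.castSucc = j.succ := by ext; simp [h]
  refine LinearMap.ext fun f => ?_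
  rw [Module.End.mul_apply, Module.End.mul_apply]
  refine map_T (A := omega q) (omega_mul hq) 1 ?_ ?_ (map_s_of_mono fun η => ?_) t f
  · rw [hk, omega_X_succ, one_mul]
  · rw [omega_X_succ, hk, one_mul]
  · rw [s_mono_comp, omega_mono, omega_mono, map_smul, s_mono_comp, Function.comp_apply,
      Equiv.swap_apply_of_ne_of_ne (by simp [hk, (Fin.succ_ne_zero j).symm])
        (Fin.succ_ne_zero k).symm]
    congr 2
    funext i
    simp only [Function.comp_apply]
    rw [(finRotate (n + 1)).injective.map_swap, finRotate_castSucc, ← finRotate_castSucc k, hk]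

/-- One ω sends x_0, x_1 to q x_n, x_0, which breaks up the pair. A second one gives q x_{n-1}, q
x_n: an adjacent pair again, with a common factor q that `map_T` tolerates. -/
theorem omega_omega_T {q : K} (hq : q ≠ 0) (t : K) {j k : Fin n} (hj : (j : ℕ) = 0)
    (hk : (k : ℕ) + 1 = n) : omega q * omega q * T t j = T t k * (omega q * omega q) := by
  have h0 : j.castSucc = 0 := by ext; simp [hj]
  have hl : k.succ = Fin.last n := by ext; simp [hk]
  have h1 : finRotate (n + 1) (finRotate (n + 1) k.castSucc) = 0 := by
    rw [finRotate_castSucc, hl, finRotate_last]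
  have h2 : finRotate (n + 1) (finRotate (n + 1) k.succ) = j.succ := by
    rw [hl, finRotate_last, ← h0, finRotate_castSucc]
  have h3 : ∀ η : Fin (n + 1) → ℤ, omega q (omega q (mono η)) =
      q ^ (η j.castSucc + η j.succ) • mono (η ∘ finRotate (n + 1) ∘ finRotate (n + 1)) := fun η => by
    rw [omega_mono, map_smul, omega_mono, smul_smul, ← zpow_add₀ hq, h0]
    rw [Function.comp_apply, ← h0, finRotate_castSucc]
    rfl
  refine LinearMap.ext fun f => ?_
  rw [Module.End.mul_apply _ (T t j), Module.End.mul_apply (T t k)]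
  refine map_T (A := omega q * omega q)
    (fun f g => ?_) (algebraMap K _ q) ?_ ?_ (map_s_of_mono fun η => ?_) t f
  · simp only [Module.End.mul_apply, omega_mul hq]
  · rw [Module.End.mul_apply, h0, omega_X_zero, map_smul, ← hl, omega_X_succ, Algebra.smul_def]
  · rw [Module.End.mul_apply, omega_X_succ, h0, omega_X_zero, hl, Algebra.smul_def]
  · rw [Module.End.mul_apply, Module.End.mul_apply, s_mono_comp, h3, h3, map_smul, s_mono_comp,
      Function.comp_apply, Function.comp_apply, Equiv.swap_apply_left, Equiv.swap_apply_right,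
      add_comm (η j.succ)]
    congr 2
    funext i
    simp only [Function.comp_apply]
    rw [(finRotate (n + 1)).injective.map_swap, (finRotate (n + 1)).injective.map_swap, h1, h2, h0]

/-- The substitution `x_i ↦ x_{n-i}⁻¹`. -/
noncomputable def flipInv : Module.End K (Laurent K n) := revVars * invVars

theorem flipInv_mono (η : Fin (n + 1) → ℤ) : (flipInv (mono η) : Laurent K n) = mono (negRev η) := by
  rw [flipInv, Module.End.mul_apply, invVars, onMono_mono, revVars, permVars, onMono_mono]
  rfl

theorem revVars_revVars (f : Laurent K n) : revVars (revVars f) = f := by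
  refine end_ext' (A := revVars * revVars) (B := 1) (fun η => ?_) f
  rw [Module.End.mul_apply, revVars, permVars, onMono_mono, onMono_mono, Module.End.one_apply]
  congr 1
  funext i
  simp

theorem invVars_revVars (f : Laurent K n) : invVars (revVars f) = revVars (invVars f) := by
  refine end_ext' (A := invVars * revVars) (B := revVars * invVars) (fun η => ?_) f
  rw [Module.End.mul_apply, Module.End.mul_apply, revVars, permVars, invVars, onMono_mono,
    onMono_mono, onMono_mono, onMono_mono]
  rfl

theorem flipInv_mul (f g : Laurent K n) : flipInv (f * g) = flipInv f * flipInv g := by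
  refine map_mul_of_mono (fun η ν => ?_) f g
  rw [flipInv_mono, flipInv_mono, flipInv_mono, mono_mul_mono]
  congr 1
  funext i
  simp only [negRev, Pi.add_apply, neg_add]

/-- Inversion and reversal each exchange the roles of the two variables, so together they restore
them: x_j and x_{j+1} become x_r and x_{r+1} divided by x_r x_{r+1}, where r = n-1-j. -/
theorem flipInv_T (t : K) (j : Fin n) (f : Laurent K n) :
    flipInv (T t j f) = T t j.rev (flipInv f) := by
  have hne : j.rev.castSucc ≠ j.rev.succ := (Fin.castSucc_lt_succ (i := j.rev)).ne
  refine map_T flipInv_mul (mono (-(Pi.single j.rev.castSucc 1 + Pi.single j.rev.succ 1))) ?_ ?_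
    (map_s_of_mono fun η => ?_) t f
  · rw [X, X, flipInv_mono, mono_mul_mono]
    congr 1
    funext i
    simp [negRev, Pi.single_apply, Fin.rev_eq_iff, Fin.rev_castSucc]
  · rw [X, X, flipInv_mono, mono_mul_mono]
    congr 1
    funext i
    simp [negRev, Pi.single_apply, Fin.rev_eq_iff, Fin.rev_succ]
  · rw [s_mono_comp, flipInv_mono, flipInv_mono, s_mono_comp]
    congr 1
    funext i
    simp only [negRev, Function.comp_apply]
    rw [Fin.rev_injective.map_swap, Fin.rev_castSucc, Fin.rev_succ, Fin.rev_rev, Equiv.swap_comm]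

/-- ω rotates exponents, and `negRev` reverses the sense of rotation. The two powers of q have
exponents η_0 and -η_0. -/
theorem omega_flipInv_omega (q : K) (hq : q ≠ 0) (f : Laurent K n) :
    omega q (flipInv (omega q f)) = flipInv f := by
  refine end_ext' (A := omega q * flipInv * omega q) (B := flipInv) (fun η => ?_) f
  rw [Module.End.mul_apply, Module.End.mul_apply, omega_mono, map_smul, flipInv_mono, map_smul,
    omega_mono, flipInv_mono, smul_smul, ← zpow_add₀ hq]
  have h : negRev (η ∘ finRotate (n + 1)) ∘ finRotate (n + 1) = negRev η := by
    funext k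
    refine Fin.lastCases ?_ (fun j => ?_) k
    · simp [negRev]
    · simp only [negRev, Function.comp_apply]
      rw [finRotate_castSucc, Fin.rev_succ, finRotate_castSucc, Fin.rev_castSucc]
  rw [h]
  simp [negRev]

theorem Tinv_flipInv_T {t : K} (ht : t ≠ 0) (j : Fin n) :
    Tinv t j.rev * flipInv * T t j = flipInv := by
  refine LinearMap.ext fun f => ?_
  rw [Module.End.mul_apply, Module.End.mul_apply, flipInv_T, ← Module.End.mul_apply, Tinv_mul_T ht,
    Module.End.one_apply]

theorem T_flipInv_Tinv {t : K} (ht : t ≠ 0) (j : Fin n) :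
    T t j.rev * flipInv * Tinv t j = flipInv := by
  refine LinearMap.ext fun f => ?_
  rw [Module.End.mul_apply, Module.End.mul_apply, ← flipInv_T, ← Module.End.mul_apply (T t j),
    T_mul_Tinv ht, Module.End.one_apply]

/-- The factors next to `flipInv` cancel by `Tinv_flipInv_T`, and the product collapses from the
inside. The flip thus exchanges the left part of Y_i with the inverse of the right part of Y_{n-i}.
-/
theorem rightProd_flipInv_leftProd {t : K} (ht : t ≠ 0) (i : Fin (n + 1)) :
    rightProd t i.rev * flipInv * leftProd t i = flipInv := by
  refine Fin.reverseInduction ?_ (fun j ih => ?_) i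
  · rw [leftProd_last, Fin.rev_last, rightProd_zero, one_mul, mul_one]
  · rw [Fin.rev_castSucc, rightProd_succ, leftProd_castSucc]
    calc _ = rightProd t j.rev.castSucc * (Tinv t j.rev * flipInv * T t j) * leftProd t j.succ := by
          simp only [mul_assoc]
      _ = flipInv := by rw [Tinv_flipInv_T ht, ← Fin.rev_succ, ih]

theorem leftProd_flipInv_rightProd {t : K} (ht : t ≠ 0) (i : Fin (n + 1)) :
    leftProd t i.rev * flipInv * rightProd t i = flipInv := by
  refine Fin.induction ?_ (fun j ih => ?_) i
  · rw [Fin.rev_zero, leftProd_last, rightProd_zero, one_mul, mul_one]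
  · rw [Fin.rev_succ, rightProd_succ, leftProd_castSucc, ← Fin.rev_castSucc]
    calc _ = T t j.rev * (leftProd t j.castSucc.rev * flipInv * rightProd t j.castSucc) * Tinv t j := by
          simp only [mul_assoc]
      _ = flipInv := by rw [ih, T_flipInv_Tinv ht]

/-- The substitution `x_i ↦ x_{n-i}⁻¹` turns `Y_i` into `t^{-n} Y_{n-i}⁻¹`. -/
theorem Y_flipInv_Y {q t : K} (hq : q ≠ 0) (ht : t ≠ 0) (i : Fin (n + 1)) (f : Laurent K n) :
    Y q t i.rev (flipInv (Y q t i f)) = t ^ (-(n : ℤ)) • flipInv f := by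
  have h1 : ∀ g : Laurent K n, rightProd t i.rev (flipInv (leftProd t i g)) = flipInv g :=
    fun g => congrArg (fun A : Module.End K (Laurent K n) => A g) (rightProd_flipInv_leftProd ht i)
  have h2 : ∀ g : Laurent K n, leftProd t i.rev (flipInv (rightProd t i g)) = flipInv g :=
    fun g => congrArg (fun A : Module.End K (Laurent K n) => A g) (leftProd_flipInv_rightProd ht i)
  simp only [Y_eq, LinearMap.smul_apply, Module.End.mul_apply, map_smul]
  rw [h1, omega_flipInv_omega q hq, h2, smul_smul, ← zpow_add₀ ht]
  congr 2
  rw [Fin.val_rev]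
  have := i.is_lt
  omega

end Cherednik

/-! ### Commutativity of the Cherednik operators. -/

section Commutativity

variable {K : Type*} [Field K] {n : ℕ}

theorem commute_Tinv {A : Module.End K (Laurent K n)} {t : K} {j : Fin n}
    (h : Commute A (T t j)) : Commute A (Tinv t j) :=
  ((Commute.one_right A).smul_right _).add_right (h.smul_right _)

/-- This recursion reduces commutation with every Y_i to commutation with earlier Y's and single
T's. -/
theorem Y_succ {q t : K} (ht : t ≠ 0) (j : Fin n) :
    Y q t j.succ = t • (Tinv t j * Y q t j.castSucc * Tinv t j) := by
  rw [Y_eq, Y_eq, leftProd_castSucc, rightProd_succ, mul_smul_comm, smul_mul_assoc, smul_smul,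
    ← zpow_one_add₀ ht]
  congr 1
  · congr 1
    simp
    ring
  · simp only [← mul_assoc]
    rw [Tinv_mul_T ht, one_mul]

theorem commute_Y_succ {A : Module.End K (Laurent K n)} {q t : K} (ht : t ≠ 0) {j : Fin n}
    (h : Commute A (Y q t j.castSucc)) (h' : Commute A (T t j)) : Commute A (Y q t j.succ) := by
  rw [Y_succ ht]
  exact (((commute_Tinv h').mul_right h).mul_right (commute_Tinv h')).smul_right t

theorem commute_leftProd {A : Module.End K (Laurent K n)} {t : K} (i : Fin (n + 1))
    (h : ∀ j : Fin n, i ≤ j.castSucc → Commute A (T t j)) : Commute A (leftProd t i) := by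
  refine Commute.list_prod_right _ _ fun B hB => ?_
  obtain ⟨j, hj, rfl⟩ := List.mem_map.1 hB
  exact h j (Fin.le_def.2 (by simpa using (List.mem_filter.1 hj).2))

/-- T_j moves left past the factors of index above j+1, becomes T_{j+1} by the braid relation, and
passes the remaining factors of index below j. -/
theorem leftProd_mul_T (t : K) (i : Fin (n + 1)) {j k : Fin n} (h : (k : ℕ) = j + 1)
    (hi : i ≤ j.castSucc) : leftProd t i * T t j = T t k * leftProd t i := by
  induction i using Fin.reverseInduction with
  | last => exact absurd hi (not_le.2 (Fin.castSucc_lt_last j))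
  | cast m ih =>
    rw [leftProd_castSucc]
    rcases (show m ≤ j from hi).lt_or_eq with hm | rfl
    · rw [mul_assoc, ih (by simpa [Fin.le_def] using hm), ← mul_assoc, ← mul_assoc,
        (T_commute_far t (show (m : ℕ) + 1 < k by have := Fin.lt_def.1 hm; omega)).eq]
    · have hk : m.succ = k.castSucc := by ext; simp [h]
      have hc : Commute (T t m) (leftProd t k.succ) := commute_leftProd _ fun l hl =>
        T_commute_far t (by have := Fin.le_def.1 hl; simp at this; omega)
      rw [hk, leftProd_castSucc, mul_assoc, mul_assoc, ← hc.eq]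
      simp only [← mul_assoc]
      rw [T_braid t h]

/-- Moving T_k leftwards through ω lowers its index by one, and T_0 ⋯ T_{n-1} raises it back. -/
theorem Y_zero_commute_T {q : K} (hq : q ≠ 0) (t : K) {k : Fin n} (hk : 0 < (k : ℕ)) :
    Commute (leftProd t 0 * omega q) (T t k) := by
  have h : (k : ℕ) = (⟨k - 1, by omega⟩ : Fin n) + 1 := by simp; omega
  rw [commute_iff_eq, mul_assoc, omega_T hq t h, ← mul_assoc, leftProd_mul_T t 0 h (Fin.zero_le _),
    mul_assoc]

theorem Y_zero (q t : K) :
    (Y q t 0 : Module.End K (Laurent K n)) = t ^ (-n : ℤ) • (leftProd t 0 * omega q) := by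
  rw [Y_eq, rightProd_zero, mul_one]
  simp

theorem Y_commute_T {q t : K} (hq : q ≠ 0) (ht : t ≠ 0) (i : Fin (n + 1)) {k : Fin n}
    (h : (i : ℕ) < k) : Commute (Y q t i) (T t k) := by
  induction i using Fin.induction with
  | zero =>
    rw [Y_zero]
    exact (Y_zero_commute_T hq t h).smul_left _
  | succ j ih =>
    have h' : (j : ℕ) + 1 < k := by simpa using h
    exact (commute_Y_succ ht (ih (by simp; omega)).symm (T_commute_far t h').symm).symm

/-- Pulling the first ω to the right lowers every index in the product by one; the missing last
factor T_{n-1} comes from T_0 passing through ω². -/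
theorem omega_leftProd_omega_T {q : K} (hq : q ≠ 0) (t : K) {j : Fin n} (hj : (j : ℕ) = 0)
    (d : ℕ) (m : Fin n) (hm : (m : ℕ) + 1 + d = n) :
    omega q * leftProd t m.succ * omega q * T t j =
      leftProd t m.castSucc * (omega q * omega q) := by
  induction d generalizing m with
  | zero =>
    have hl : m.succ = Fin.last n := by ext; simpa using hm
    rw [leftProd_castSucc, hl, leftProd_last, mul_one, mul_one, omega_omega_T hq t hj hm]
  | succ d ih =>
    let k : Fin n := ⟨m + 1, by omega⟩
    have hk : m.succ = k.castSucc := rfl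
    rw [leftProd_castSucc, hk, leftProd_castSucc, ← mul_assoc, omega_T hq t (j := m) (k := k) rfl,
      mul_assoc, mul_assoc, mul_assoc, ← mul_assoc (omega q), ← mul_assoc _ (omega q),
      ih k (by simp [k]; omega), leftProd_castSucc, mul_assoc, mul_assoc, mul_assoc]

/-- With Z = T_1 ⋯ T_{n-1} ω, the two operators are multiples of T_0 Z and Z T_0⁻¹, so the claim
reduces to Z² commuting with T_0. -/
theorem Y_zero_commute_Y_one {q t : K} (hq : q ≠ 0) (ht : t ≠ 0) {j : Fin n} (hj : (j : ℕ) = 0) :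
    Commute (Y q t j.castSucc) (Y q t j.succ) := by
  have h0 : j.castSucc = 0 := by ext; simp [hj]
  set Z := leftProd t j.succ * omega q with hZ
  have h1 : leftProd t 0 * omega q = T t j * Z := by rw [← h0, leftProd_castSucc, mul_assoc]
  have h2 : Z * Z * T t j = T t j * (Z * Z) := by
    have hc : Commute (leftProd t 0 * omega q) (leftProd t j.succ) :=
      commute_leftProd _ fun k hk =>
        Y_zero_commute_T hq t (by have := Fin.le_def.1 hk; simp at this; omega)
    calc Z * Z * T t j = leftProd t j.succ * (omega q * leftProd t j.succ * omega q * T t j) := by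
          simp only [hZ, mul_assoc]
      _ = leftProd t j.succ * (leftProd t 0 * (omega q * omega q)) := by
          rw [omega_leftProd_omega_T hq t hj (n - (j + 1)) j (by omega), h0]
      _ = (leftProd t 0 * omega q) * leftProd t j.succ * omega q := by
          rw [hc.eq]; simp only [mul_assoc]
      _ = T t j * (Z * Z) := by rw [h1]; simp only [hZ, mul_assoc]
  rw [Y_succ ht, h0, Y_zero, h1]
  refine Commute.smul_right ?_ _
  rw [mul_smul_comm, smul_mul_assoc]
  refine (Commute.smul_right ?_ _).smul_left _
  rw [← mul_assoc (Tinv t j), Tinv_mul_T ht, one_mul, commute_iff_eq]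
  calc T t j * Z * (Z * Tinv t j) = T t j * (Z * Z) * Tinv t j := by simp only [mul_assoc]
    _ = Z * Z * (T t j * Tinv t j) := by rw [← h2, mul_assoc]
    _ = Z * (Tinv t j * T t j) * Z := by rw [T_mul_Tinv ht, Tinv_mul_T ht, mul_one, mul_one]
    _ = Z * Tinv t j * (T t j * Z) := by simp only [mul_assoc]

/-- Y_{j+2} is a multiple of T_{j+1}⁻¹ T_j⁻¹ Y_j T_j⁻¹ T_{j+1}⁻¹. The braid relation turns T_j into
T_{j+1} on its way to Y_j, with which it commutes, and back into T_j afterwards. -/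
theorem T_commute_Y {q t : K} (hq : q ≠ 0) (ht : t ≠ 0) {j k : Fin n} (h : (k : ℕ) = j + 1) :
    Commute (T t j) (Y q t k.succ) := by
  have hk : k.castSucc = j.succ := by ext; simp [h]
  have hb : Commute (Y q t j.castSucc) (T t k) := Y_commute_T hq ht _ (by simp [h])
  have h1 : T t j * (Tinv t k * Tinv t j) = Tinv t k * Tinv t j * T t k := by
    calc _ = Tinv t k * Tinv t j * (T t j * T t k * T t j) * (Tinv t k * Tinv t j) := by
          simp only [← mul_assoc]
          rw [mul_assoc (Tinv t k), Tinv_mul_T ht, mul_one, Tinv_mul_T ht, one_mul]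
      _ = Tinv t k * Tinv t j * T t k * (T t j * (T t k * Tinv t k) * Tinv t j) := by
          rw [T_braid t h]; simp only [mul_assoc]
      _ = _ := by rw [T_mul_Tinv ht, mul_one, T_mul_Tinv ht, mul_one]
  have h2 : Tinv t j * Tinv t k * T t j = T t k * (Tinv t j * Tinv t k) := by
    calc _ = Tinv t j * Tinv t k * (T t j * T t k * T t j) * (Tinv t j * Tinv t k) := by
          simp only [mul_assoc]
          rw [← mul_assoc (T t j) (Tinv t j), T_mul_Tinv ht, one_mul, T_mul_Tinv ht, mul_one]
      _ = (Tinv t j * (Tinv t k * T t k) * T t j) * T t k * (Tinv t j * Tinv t k) := by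
          rw [T_braid t h]; simp only [mul_assoc]
      _ = _ := by rw [Tinv_mul_T ht, mul_one, Tinv_mul_T ht, one_mul]
  rw [Y_succ ht, hk, Y_succ ht, mul_smul_comm, smul_mul_assoc]
  refine (Commute.smul_right ?_ _).smul_right _
  rw [commute_iff_eq]
  calc _ = T t j * (Tinv t k * Tinv t j) * Y q t j.castSucc * (Tinv t j * Tinv t k) := by
        simp only [mul_assoc]
    _ = Tinv t k * Tinv t j * (T t k * Y q t j.castSucc) * (Tinv t j * Tinv t k) := by
        rw [h1]; simp only [mul_assoc]
    _ = Tinv t k * Tinv t j * Y q t j.castSucc * (Tinv t j * Tinv t k * T t j) := by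
        rw [h2, ← hb.eq]; simp only [mul_assoc]
    _ = _ := by simp only [mul_assoc]

/-- If Y_{j-1} commutes with Y_j then it commutes with Y_{j+1}, as it commutes with T_j. Now Y_{j+1}
commutes with both Y_{j-1} and T_{j-1}, hence with Y_j. -/
theorem Y_commute_Y_succ {q t : K} (hq : q ≠ 0) (ht : t ≠ 0) (d : ℕ) (j : Fin n)
    (hj : (j : ℕ) = d) : Commute (Y q t j.castSucc) (Y q t j.succ) := by
  induction d generalizing j with
  | zero => exact Y_zero_commute_Y_one hq ht hj
  | succ d ih =>
    let i : Fin n := ⟨d, by omega⟩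
    have hji : j.castSucc = i.succ := by ext; simp [hj, i]
    have hy : Commute (Y q t i.castSucc) (Y q t j.succ) :=
      commute_Y_succ ht (hji ▸ ih i rfl) (Y_commute_T hq ht _ (by simp [hj, i]))
    rw [hji]
    exact (commute_Y_succ ht hy.symm (T_commute_Y hq ht (by simp [hj, i])).symm).symm

theorem Y_commute_of_le {q t : K} (hq : q ≠ 0) (ht : t ≠ 0) (i : Fin (n + 1)) (d : ℕ) (j : Fin n)
    (hj : (j : ℕ) = i + d) : Commute (Y q t i) (Y q t j.succ) := by
  induction d generalizing j with
  | zero =>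
    have hi : i = j.castSucc := by ext; simp [hj]
    exact hi ▸ Y_commute_Y_succ hq ht _ j rfl
  | succ d ih =>
    let k : Fin n := ⟨i + d, by omega⟩
    have hjk : j.castSucc = k.succ := by ext; simp [hj, k, add_assoc]
    exact commute_Y_succ ht (hjk ▸ ih k rfl) (Y_commute_T hq ht _ (by omega))

/-- The Cherednik operators commute. -/
theorem Y_commute {q t : K} (hq : q ≠ 0) (ht : t ≠ 0) (i j : Fin (n + 1)) :
    Commute (Y q t i) (Y q t j) := by
  have h : ∀ i j : Fin (n + 1), i < j → Commute (Y q t i) (Y q t j) := fun i j hij => by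
    obtain ⟨k, rfl⟩ := Fin.exists_succ_eq.2 ((Fin.zero_le i).trans_lt hij).ne'
    have := Fin.lt_def.1 hij
    rw [Fin.val_succ] at this
    exact Y_commute_of_le hq ht i (k - i) k (by omega)
  rcases lt_trichotomy i j with hij | rfl | hij
  · exact h i j hij
  · exact Commute.refl _
  · exact (h j i hij).symm

end Commutativity

/-! ### Supports of Laurent polynomials and the action of one T_j on monomials. -/

section Supports

variable {K : Type*} [Field K] {n : ℕ}

/-- The Laurent polynomials all of whose exponents satisfy `P`. -/
noncomputable def supportedOn (K : Type*) [Field K] {n : ℕ} (P : (Fin (n + 1) → ℤ) → Prop) :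
    Submodule K (Laurent K n) where
  carrier := {f | ∀ ν, f.coeff ν ≠ 0 → P ν}
  zero_mem' ν h := absurd rfl h
  add_mem' {f g} hf hg ν h := by
    by_contra hP
    have h1 := not_not.1 (mt (hf ν) hP)
    have h2 := not_not.1 (mt (hg ν) hP)
    exact h (by rw [AddMonoidAlgebra.coeff_add, Finsupp.add_apply, h1, h2, add_zero])
  smul_mem' c f hf ν h := hf ν fun h0 => h (by
    rw [AddMonoidAlgebra.coeff_smul, Finsupp.smul_apply, h0, smul_zero])

theorem coeff_mono_self (η : Fin (n + 1) → ℤ) : (mono η : Laurent K n).coeff η = 1 := by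
  simp [mono]

theorem coeff_mono_of_ne {η ν : Fin (n + 1) → ℤ} (h : η ≠ ν) :
    (mono η : Laurent K n).coeff ν = 0 := by
  simp [mono, h]

theorem mono_mem_supportedOn {P : (Fin (n + 1) → ℤ) → Prop} {η : Fin (n + 1) → ℤ} (h : P η) :
    (mono η : Laurent K n) ∈ supportedOn K P := fun ν hν => by
  by_cases e : η = ν
  · exact e ▸ h
  · exact absurd (coeff_mono_of_ne e) hν

theorem supportedOn_le {P Q : (Fin (n + 1) → ℤ) → Prop} (h : ∀ ν, P ν → Q ν) :
    supportedOn K P ≤ supportedOn K Q := fun _ hf ν hν => h ν (hf ν hν)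

theorem map_mem_supportedOn {P Q : (Fin (n + 1) → ℤ) → Prop} {A : Module.End K (Laurent K n)}
    (h : ∀ ν, P ν → A (mono ν) ∈ supportedOn K Q) {f : Laurent K n} (hf : f ∈ supportedOn K P) :
    A f ∈ supportedOn K Q := by
  rw [← f.sum_coeff_single, Finsupp.sum, map_sum]
  refine Submodule.sum_mem _ fun ν hν => ?_
  have : (AddMonoidAlgebra.single ν (f.coeff ν) : Laurent K n) = f.coeff ν • mono ν := by
    simp [mono]
  rw [this, map_smul]
  exact Submodule.smul_mem _ _ (h ν (hf ν (Finsupp.mem_support_iff.1 hν)))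

/-- Exponents whose decreasing rearrangement is strictly dominated by `l`. -/
def PlusLT (l ν : Fin (n + 1) → ℤ) : Prop :=
  DomLT (plus ν) l ∧ ∑ i, plus ν i = ∑ i, l i

theorem PlusLT.trans {l ν ρ : Fin (n + 1) → ℤ} (h : PlusLT (plus ν) ρ) (h' : PlusLT l ν) :
    PlusLT l ρ := ⟨h.1.trans h'.1, h.2.trans h'.2⟩

theorem PlusLT.prec {ν η : Fin (n + 1) → ℤ} (h : PlusLT (plus η) ν) : Prec ν η :=
  ⟨by simpa only [sum_plus_comp _ fun x => x] using h.2, Or.inl h.1⟩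

theorem setPair_of_ne (η : Fin (n + 1) → ℤ) (j : Fin n) (u v : ℤ) {i : Fin (n + 1)}
    (h1 : i ≠ j.castSucc) (h2 : i ≠ j.succ) : setPair η j u v i = η i := by
  simp [setPair, h1, h2]

theorem setPair_castSucc (η : Fin (n + 1) → ℤ) (j : Fin n) (u v : ℤ) :
    setPair η j u v j.castSucc = u := by
  simp [setPair, (Fin.castSucc_lt_succ (i := j)).ne]

theorem setPair_succ (η : Fin (n + 1) → ℤ) (j : Fin n) (u v : ℤ) :
    setPair η j u v j.succ = v := by
  simp [setPair]

theorem sum_setPair (η : Fin (n + 1) → ℤ) (j : Fin n) (u v : ℤ) (g : ℤ → ℤ)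
    {S : Finset (Fin (n + 1))} (h1 : j.castSucc ∈ S) (h2 : j.succ ∈ S) :
    ∑ i ∈ S, g (setPair η j u v i) + (g (η j.castSucc) + g (η j.succ)) =
      ∑ i ∈ S, g (η i) + (g u + g v) := by
  have hne : j.succ ≠ j.castSucc := (Fin.castSucc_lt_succ (i := j)).ne'
  have h : ∀ f : Fin (n + 1) → ℤ, ∑ i ∈ S, f i =
      f j.castSucc + (f j.succ + ∑ i ∈ (S.erase j.castSucc).erase j.succ, f i) := fun f => by
    rw [Finset.add_sum_erase _ _ (Finset.mem_erase.2 ⟨hne, h2⟩), Finset.add_sum_erase _ _ h1]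
  have h3 : ∑ i ∈ (S.erase j.castSucc).erase j.succ, g (setPair η j u v i) =
      ∑ i ∈ (S.erase j.castSucc).erase j.succ, g (η i) := Finset.sum_congr rfl fun i hi => by
    simp only [Finset.mem_erase] at hi
    rw [setPair_of_ne η j u v hi.2.1 hi.1]
  rw [h fun i => g (setPair η j u v i), h fun i => g (η i), setPair_castSucc, setPair_succ, h3]
  ring

/-- Moving two adjacent exponents strictly towards each other decreases the rearrangement. -/
theorem plusLT_setPair {η : Fin (n + 1) → ℤ} {j : Fin n} {u v : ℤ}
    (hs : u + v = η j.castSucc + η j.succ)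
    (h : η j.castSucc < u ∧ u < η j.succ ∨ η j.succ < u ∧ u < η j.castSucc) :
    PlusLT (plus η) (setPair η j u v) := by
  refine ⟨⟨fun e => ?_, fun p => ?_⟩, ?_⟩
  -- Strictness: the sum of squares does not change under rearrangement, but drops when the two
  -- parts approach each other.
  · have h1 := sum_setPair η j u v (fun x => x ^ 2) (Finset.mem_univ _) (Finset.mem_univ _)
    rw [← sum_plus_comp _ fun x => x ^ 2, ← sum_plus_comp η fun x => x ^ 2, e] at h1
    have h2 : 0 < (u - η j.castSucc) * (η j.succ - u) := by
      rcases h with h | h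
      · exact mul_pos (by omega) (by omega)
      · exact mul_pos_of_neg_of_neg (by omega) (by omega)
    have h3 : v = η j.castSucc + η j.succ - u := by omega
    subst h3
    nlinarith
  · obtain ⟨S, hS, hS'⟩ := exists_sum_eq_sum_plus (setPair η j u v) p
    rw [← hS']
    -- If S contains just one of the two positions, its new part is at most the larger old one; σ
    -- moves S to the position of that one.
    have key : ∀ σ : Equiv.Perm (Fin (n + 1)), (∀ i ∈ S, setPair η j u v i ≤ η (σ i)) →
        ∑ i ∈ S, setPair η j u v i ≤ ∑ i ∈ Finset.Iic p, plus η i := fun σ hσ => by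
      refine (Finset.sum_le_sum hσ).trans ?_
      have := sum_le_sum_plus η p (S.map σ.toEmbedding) (by simpa)
      simpa using this
    by_cases h1 : j.castSucc ∈ S <;> by_cases h2 : j.succ ∈ S
    · have h3 := sum_setPair η j u v (fun x => x) h1 h2
      have h4 := sum_le_sum_plus η p S hS
      omega
    · rcases le_total (η j.castSucc) (η j.succ) with hle | hle
      · refine key (Equiv.swap j.castSucc j.succ) fun i hi => ?_
        by_cases hi1 : i = j.castSucc
        · rw [hi1, setPair_castSucc, Equiv.swap_apply_left]; omega
        · have hi2 : i ≠ j.succ := fun e => h2 (e ▸ hi)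
          rw [setPair_of_ne η j u v hi1 hi2, Equiv.swap_apply_of_ne_of_ne hi1 hi2]
      · refine key 1 fun i hi => ?_
        by_cases hi1 : i = j.castSucc
        · rw [hi1, setPair_castSucc, Equiv.Perm.one_apply]; omega
        · rw [setPair_of_ne η j u v hi1 fun e => h2 (e ▸ hi), Equiv.Perm.one_apply]
    · rcases le_total (η j.succ) (η j.castSucc) with hle | hle
      · refine key (Equiv.swap j.castSucc j.succ) fun i hi => ?_
        by_cases hi1 : i = j.succ
        · rw [hi1, setPair_succ, Equiv.swap_apply_right]; omega
        · have hi2 : i ≠ j.castSucc := fun e => h1 (e ▸ hi)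
          rw [setPair_of_ne η j u v hi2 hi1, Equiv.swap_apply_of_ne_of_ne hi2 hi1]
      · refine key 1 fun i hi => ?_
        by_cases hi1 : i = j.succ
        · rw [hi1, setPair_succ, Equiv.Perm.one_apply]; omega
        · rw [setPair_of_ne η j u v (fun e => h1 (e ▸ hi)) hi1, Equiv.Perm.one_apply]
    · refine key 1 fun i hi => ?_
      rw [setPair_of_ne η j u v (fun e => h1 (e ▸ hi)) (fun e => h2 (e ▸ hi)), Equiv.Perm.one_apply]
  · have h1 := sum_setPair η j u v (fun x => x) (Finset.mem_univ _) (Finset.mem_univ _)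
    rw [sum_plus_comp _ fun x => x, sum_plus_comp _ fun x => x]
    omega

theorem setPair_swap (η : Fin (n + 1) → ℤ) (j : Fin n) :
    setPair η j (η j.succ) (η j.castSucc) = η ∘ Equiv.swap j.castSucc j.succ := by
  funext i
  by_cases h1 : i = j.castSucc
  · rw [h1, setPair_castSucc, Function.comp_apply, Equiv.swap_apply_left]
  by_cases h2 : i = j.succ
  · rw [h2, setPair_succ, Function.comp_apply, Equiv.swap_apply_right]
  rw [setPair_of_ne η j _ _ h1 h2, Function.comp_apply, Equiv.swap_apply_of_ne_of_ne h1 h2]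

/-- The two shifted copies of the sum overlap except at one end each. These ends are the leading
terms, and the overlap acquires the factor t - 1. -/
theorem mul_sum_setPair (t : K) (j : Fin n) (η : Fin (n + 1) → ℤ) (a c : ℤ) (d : ℕ) :
    (t • X j.castSucc - X j.succ) *
        ∑ k ∈ Finset.range (d + 1), mono (setPair η j (a + k) (c - 1 - k)) =
      t • mono (setPair η j (a + d + 1) (c - d - 1)) - mono (setPair η j a c) +
        (t - 1) • ∑ k ∈ Finset.range d, (mono (setPair η j (a + k + 1) (c - k - 1)) : Laurent K n) := by
  have h1 : ∀ k : ℕ, (t • X j.castSucc - X j.succ : Laurent K n) *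
      mono (setPair η j (a + k) (c - 1 - k)) =
        t • mono (setPair η j (a + k + 1) (c - k - 1)) - mono (setPair η j (a + k) (c - k)) :=
    fun k => by
      rw [sub_mul, smul_mul_assoc, X_mul_setPair_left, X_mul_setPair_right,
        show c - 1 - k + 1 = c - k by ring, show c - 1 - (k : ℤ) = c - k - 1 by ring]
  rw [Finset.mul_sum, Finset.sum_congr rfl fun k _ => h1 k, Finset.sum_sub_distrib,
    ← Finset.smul_sum, Finset.sum_range_succ, Finset.sum_range_succ' fun k : ℕ =>
      (mono (setPair η j (a + k) (c - k)) : Laurent K n)]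
  have h2 : ∀ k : ℕ, (mono (setPair η j (a + (k + 1 : ℕ)) (c - (k + 1 : ℕ))) : Laurent K n) =
      mono (setPair η j (a + k + 1) (c - k - 1)) := fun k => by
    congr 2 <;> push_cast <;> ring
  simp only [h2, Nat.cast_zero, add_zero, sub_zero]
  rw [smul_add, sub_smul, one_smul]
  abel

theorem T_mono_of_eq (t : K) {j : Fin n} {η : Fin (n + 1) → ℤ} (h : η j.castSucc = η j.succ) :
    T t j (mono η) = t • mono η := by
  rw [T_apply, divDiff, onMono_mono, h]
  simp

/-- The end terms in `mul_sum_setPair` are the swapped and the original exponent; all others have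
their two parts strictly in between, so `plusLT_setPair` applies. -/
theorem T_mono_of_lt (t : K) {j : Fin n} {η : Fin (n + 1) → ℤ} (h : η j.castSucc < η j.succ) :
    T t j (mono η) - ((t - 1) • mono η + t • mono (η ∘ Equiv.swap j.castSucc j.succ)) ∈
      supportedOn K (PlusLT (plus η)) := by
  obtain ⟨d, hd⟩ : ∃ d : ℕ, η j.succ = η j.castSucc + d + 1 :=
    ⟨(η j.succ - η j.castSucc - 1).toNat, by omega⟩
  have h1 : T t j (mono η) - ((t - 1) • mono η + t • mono (η ∘ Equiv.swap j.castSucc j.succ)) =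
      (t - 1) • ∑ k ∈ Finset.range d, (mono (setPair η j (η j.castSucc + k + 1)
        (η j.succ - k - 1)) : Laurent K n) := by
    rw [T_apply, divDiff, onMono_mono,
      show (η j.succ - η j.castSucc).toNat = d + 1 by omega,
      show (η j.castSucc - η j.succ).toNat = 0 by omega, Finset.range_zero, Finset.sum_empty,
      sub_zero, mul_sum_setPair, setPair_self, ← setPair_swap, ← hd,
      show η j.succ - d - 1 = η j.castSucc by omega, sub_smul t 1 (mono η), one_smul]
    abel
  rw [h1]
  refine Submodule.smul_mem _ _ (Submodule.sum_mem _ fun k hk => mono_mem_supportedOn ?_)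
  have := Finset.mem_range.1 hk
  exact plusLT_setPair (by ring) (Or.inl (by omega))

theorem T_mono_of_gt (t : K) {j : Fin n} {η : Fin (n + 1) → ℤ} (h : η j.succ < η j.castSucc) :
    T t j (mono η) - mono (η ∘ Equiv.swap j.castSucc j.succ) ∈
      supportedOn K (PlusLT (plus η)) := by
  obtain ⟨d, hd⟩ : ∃ d : ℕ, η j.castSucc = η j.succ + d + 1 :=
    ⟨(η j.castSucc - η j.succ - 1).toNat, by omega⟩
  have h1 : T t j (mono η) - mono (η ∘ Equiv.swap j.castSucc j.succ) =
      - ((t - 1) • ∑ k ∈ Finset.range d, (mono (setPair η j (η j.succ + k + 1)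
        (η j.castSucc - k - 1)) : Laurent K n)) := by
    rw [T_apply, divDiff, onMono_mono,
      show (η j.castSucc - η j.succ).toNat = d + 1 by omega,
      show (η j.succ - η j.castSucc).toNat = 0 by omega, Finset.range_zero, Finset.sum_empty,
      zero_sub, mul_neg, mul_sum_setPair, ← setPair_swap, ← hd,
      show η j.castSucc - d - 1 = η j.succ by omega, setPair_self]
    abel
  rw [h1]
  refine Submodule.neg_mem _ (Submodule.smul_mem _ _ (Submodule.sum_mem _ fun k hk =>
    mono_mem_supportedOn ?_))
  have := Finset.mem_range.1 hk
  exact plusLT_setPair (by ring) (Or.inr (by omega))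

theorem comp_swap_of_eq {j : Fin n} {η : Fin (n + 1) → ℤ} (h : η j.castSucc = η j.succ) :
    η ∘ Equiv.swap j.castSucc j.succ = η := by
  rw [← setPair_swap, ← h]
  conv_lhs => rw [h]
  exact h ▸ setPair_self j η

/-- The exponents which `T_j` produces out of `x ^ η` besides the interchanged one. -/
theorem T_mono (t : K) (j : Fin n) (η : Fin (n + 1) → ℤ) :
    T t j (mono η) - t ^ (if η j.castSucc ≤ η j.succ then 1 else 0) •
        mono (η ∘ Equiv.swap j.castSucc j.succ) ∈
      supportedOn K fun ν => ν = η ∧ η j.castSucc < η j.succ ∨ PlusLT (plus η) ν := by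
  rcases lt_trichotomy (η j.castSucc) (η j.succ) with h | h | h
  · rw [if_pos h.le, pow_one, ← sub_add_cancel (T t j (mono η) - _) ((t - 1) • mono η)]
    refine Submodule.add_mem _ (supportedOn_le (fun ν hν => Or.inr hν) ?_)
      (Submodule.smul_mem _ _ (mono_mem_supportedOn (Or.inl ⟨rfl, h⟩)))
    convert T_mono_of_lt t h using 1
    abel
  · rw [if_pos h.le, pow_one, T_mono_of_eq t h, comp_swap_of_eq h, sub_self]
    exact Submodule.zero_mem _
  · rw [if_neg h.not_ge, pow_zero, one_smul]
    exact supportedOn_le (fun ν hν => Or.inr hν) (T_mono_of_gt t h)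

/-- The correction t⁻¹ - 1 cancels the original monomial where T_j keeps it, and creates it in the
opposite case; hence the reversed inequality compared with `T_mono`. -/
theorem Tinv_mono {t : K} (ht : t ≠ 0) (j : Fin n) (η : Fin (n + 1) → ℤ) :
    Tinv t j (mono η) - t⁻¹ ^ (if η j.succ ≤ η j.castSucc then 1 else 0) •
        mono (η ∘ Equiv.swap j.castSucc j.succ) ∈
      supportedOn K fun ν => ν = η ∧ η j.succ < η j.castSucc ∨ PlusLT (plus η) ν := by
  have hT : Tinv t j (mono η) = (t⁻¹ - 1) • mono η + t⁻¹ • T t j (mono η) := rfl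
  rcases lt_trichotomy (η j.castSucc) (η j.succ) with h | h | h
  · rw [if_neg h.not_ge, pow_zero, one_smul]
    have h1 := Submodule.smul_mem _ t⁻¹ (T_mono_of_lt t h)
    refine supportedOn_le (fun ν hν => Or.inr hν) ?_
    convert h1 using 1
    rw [hT, smul_sub, smul_add, smul_smul, smul_smul, inv_mul_cancel₀ ht, one_smul, mul_sub,
      inv_mul_cancel₀ ht, mul_one, sub_smul, sub_smul]
    abel
  · rw [if_pos h.ge, pow_one, hT, T_mono_of_eq t h, comp_swap_of_eq h, smul_smul,
      inv_mul_cancel₀ ht, sub_smul, sub_add_cancel, sub_self]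
    exact Submodule.zero_mem _
  · rw [if_pos h.le, pow_one, hT, add_sub_assoc, ← smul_sub]
    exact Submodule.add_mem _ (Submodule.smul_mem _ _ (mono_mem_supportedOn (Or.inl ⟨rfl, h⟩)))
      (supportedOn_le (fun ν hν => Or.inr hν) (Submodule.smul_mem _ _ (T_mono_of_gt t h)))

end Supports

/-! ### Triangularity of the Cherednik operators. -/

section Triangularity

variable {K : Type*} [Field K] {n : ℕ}

/-- Composition rule for leading terms: coefficients multiply, provided that A maps the error of the
first step into the allowed error. -/
theorem map_sub_smul_mem {A : Module.End K (Laurent K n)} {f g h : Laurent K n} {c d : K}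
    {P Q : (Fin (n + 1) → ℤ) → Prop} (hf : f - c • g ∈ supportedOn K P)
    (hP : ∀ ν, P ν → A (mono ν) ∈ supportedOn K Q) (hg : A g - d • h ∈ supportedOn K Q) :
    A f - (d * c) • h ∈ supportedOn K Q := by
  have h1 := Submodule.add_mem _ (map_mem_supportedOn hP hf) (Submodule.smul_mem _ c hg)
  rw [map_sub, map_smul, smul_sub, smul_smul, mul_comm c, sub_add_sub_cancel] at h1
  exact h1

theorem mem_of_sub_smul_mem {f : Laurent K n} {c : K} {η : Fin (n + 1) → ℤ}
    {P : (Fin (n + 1) → ℤ) → Prop} (hf : f - c • mono η ∈ supportedOn K P) (hη : P η) :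
    f ∈ supportedOn K P := by
  rw [← sub_add_cancel f (c • mono η)]
  exact Submodule.add_mem _ hf (Submodule.smul_mem _ c (mono_mem_supportedOn hη))

/-- The exponents which occur in `T_0⁻¹ ⋯ T_{i-1}⁻¹ x ^ μ` with the rearrangement of `μ`. -/
def RightBound (i : Fin (n + 1)) (μ ν : Fin (n + 1) → ℤ) : Prop :=
  plus ν = plus μ ∧ (∀ k : Fin n, ν k.succ ≤ μ (i.succAbove k)) ∧
    ∀ k : Fin n, i ≤ k.castSucc → ν k.succ = μ k.succ

theorem plus_cons_removeNth (i : Fin (n + 1)) (μ : Fin (n + 1) → ℤ) :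
    plus (Fin.cons (μ i) (i.removeNth μ) : Fin (n + 1) → ℤ) = plus μ := by
  rw [Fin.cons_removeNth_eq_comp_cycleRange_symm]
  exact plus_comp_perm μ _

theorem rightBound_cons (i : Fin (n + 1)) (μ : Fin (n + 1) → ℤ) :
    RightBound i μ (Fin.cons (μ i) (i.removeNth μ) : Fin (n + 1) → ℤ) := by
  refine ⟨plus_cons_removeNth i μ, fun k => ?_, fun k hk => ?_⟩
  · rw [Fin.cons_succ, Fin.removeNth_apply]
  · rw [Fin.cons_succ, Fin.removeNth_apply, Fin.succAbove_of_le_castSucc _ _ hk]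

theorem succAbove_castSucc_eq {j k : Fin n} (h : k ≠ j) :
    j.castSucc.succAbove k = j.succ.succAbove k := by
  rw [← swap_succAbove, Equiv.swap_apply_of_ne_of_ne (Fin.succAbove_ne _ _)]
  intro e
  rw [← Fin.succAbove_castSucc_self j] at e
  exact h (Fin.succAbove_right_injective e)

theorem card_filter_lt_succ (j : Fin n) (P : Fin (n + 1) → Prop) [DecidablePred P] :
    (Finset.univ.filter fun k => k < j.succ ∧ P k).card =
      (Finset.univ.filter fun k => k < j.castSucc ∧ P k).card + if P j.castSucc then 1 else 0 := by
  have h : (Finset.univ.filter fun k => k < j.succ ∧ P k) =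
      (Finset.univ.filter fun k => k < j.castSucc ∧ P k) ∪
        if P j.castSucc then {j.castSucc} else ∅ := by
    ext k
    have : k < j.succ ↔ k < j.castSucc ∨ k = j.castSucc := by
      simp only [Fin.lt_def, Fin.ext_iff, Fin.val_succ, Fin.val_castSucc]; omega
    split_ifs with hP
    · simp only [Finset.mem_filter, Finset.mem_univ, true_and, Finset.mem_union,
        Finset.mem_singleton, this]
      constructor
      · tauto
      · rintro (h | rfl)
        · exact ⟨Or.inl h.1, h.2⟩
        · exact ⟨Or.inr rfl, hP⟩
    · simp only [Finset.mem_filter, Finset.mem_univ, true_and, Finset.mem_union, this,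
        Finset.notMem_empty, or_false]
      constructor
      · rintro ⟨h | rfl, h'⟩
        · exact ⟨h, h'⟩
        · exact absurd h' hP
      · tauto
  rw [h, Finset.card_union_of_disjoint]
  · split_ifs <;> simp
  · split_ifs <;> simp

theorem card_filter_le_castSucc (j : Fin n) (P : Fin n → Prop) [DecidablePred P] :
    (Finset.univ.filter fun k : Fin n => j.castSucc ≤ k.castSucc ∧ P k).card =
      (if P j then 1 else 0) +
        (Finset.univ.filter fun k : Fin n => j.succ ≤ k.castSucc ∧ P k).card := by
  have h : (Finset.univ.filter fun k : Fin n => j.castSucc ≤ k.castSucc ∧ P k) =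
      (if P j then {j} else ∅) ∪
        (Finset.univ.filter fun k : Fin n => j.succ ≤ k.castSucc ∧ P k) := by
    ext k
    have : j.castSucc ≤ k.castSucc ↔ k = j ∨ j.succ ≤ k.castSucc := by
      simp only [Fin.le_def, Fin.ext_iff, Fin.val_succ, Fin.val_castSucc]; omega
    split_ifs with hP
    · simp only [Finset.mem_filter, Finset.mem_univ, true_and, Finset.mem_union,
        Finset.mem_singleton, this]
      constructor
      · tauto
      · rintro (rfl | h)
        · exact ⟨Or.inl rfl, hP⟩
        · exact ⟨Or.inr h.1, h.2⟩
    · simp only [Finset.mem_filter, Finset.mem_univ, true_and, Finset.mem_union, this,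
        Finset.notMem_empty, false_or]
      constructor
      · rintro ⟨rfl | h, h'⟩
        · exact absurd h' hP
        · exact ⟨h, h'⟩
      · tauto
  rw [h, Finset.card_union_of_disjoint]
  · split_ifs <;> simp
  · split_ifs
    · rw [Finset.disjoint_singleton_left]
      simp [Fin.le_def]
    · simp

/-- The leading term carries μ_i to the front, with a factor t⁻¹ for each part passed that is at
least μ_i. The factor acting first either swaps, which reduces to the swapped μ, or leaves μ alone.
-/
theorem rightProd_mono {t : K} (ht : t ≠ 0) (i : Fin (n + 1)) (μ : Fin (n + 1) → ℤ) :
    rightProd t i (mono μ) -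
        t⁻¹ ^ (Finset.univ.filter fun k => k < i ∧ μ i ≤ μ k).card •
          mono (Fin.cons (μ i) (i.removeNth μ)) ∈
      supportedOn K fun ν => PlusLT (plus μ) ν ∨
        RightBound i μ ν ∧ ∃ k : Fin n, ν k.succ ≠ μ (i.succAbove k) := by
  induction i using Fin.induction generalizing μ with
  | zero =>
    rw [rightProd_zero, Module.End.one_apply, Fin.removeNth_zero, Fin.cons_self_tail]
    simp
  | succ j ih =>
    have hswap := ih (μ ∘ Equiv.swap j.castSucc j.succ)
    rw [rightProd_succ, Module.End.mul_apply]
    have hcard : t⁻¹ ^ (Finset.univ.filter fun k => k < j.succ ∧ μ j.succ ≤ μ k).card =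
        t⁻¹ ^ (Finset.univ.filter fun k => k < j.castSucc ∧
          (μ ∘ Equiv.swap j.castSucc j.succ) j.castSucc ≤
            (μ ∘ Equiv.swap j.castSucc j.succ) k).card *
          t⁻¹ ^ (if μ j.succ ≤ μ j.castSucc then 1 else 0) := by
      rw [card_filter_lt_succ, pow_add]
      congr 3
      refine Finset.filter_congr fun k _ => and_congr_right fun hk => ?_
      rw [Function.comp_apply, Function.comp_apply, Equiv.swap_apply_left,
        Equiv.swap_apply_of_ne_of_ne hk.ne (hk.trans Fin.castSucc_lt_succ).ne]
    rw [hcard]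
    refine map_sub_smul_mem (Tinv_mono ht j μ) (fun ν hν => ?_) ?_
    · rcases hν with ⟨rfl, hν⟩ | hν
      -- The exponent was left alone, which needs a strict descent at j; this makes the bound at j
      -- strict.
      · have key : ∀ ρ, RightBound j.castSucc ν ρ → RightBound j.succ ν ρ ∧
            ∃ k : Fin n, ρ k.succ ≠ ν (j.succ.succAbove k) := fun ρ ⟨h1, h2, h3⟩ => by
          have hj : ρ j.succ < ν (j.succ.succAbove j) := by
            rw [h3 j le_rfl, Fin.succAbove_succ_self]; exact hν
          refine ⟨⟨h1, fun k => ?_, fun k hk => h3 k (Fin.castSucc_lt_succ.le.trans hk)⟩, j, hj.ne⟩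
          by_cases hkj : k = j
          · rw [hkj]; exact hj.le
          · rw [← succAbove_castSucc_eq hkj]; exact h2 k
        refine mem_of_sub_smul_mem (supportedOn_le ?_ (ih ν)) (Or.inr (key _ (rightBound_cons _ _)))
        exact fun ρ hρ => hρ.imp id fun h => key ρ h.1
      · refine mem_of_sub_smul_mem (supportedOn_le ?_ (ih ν)) (Or.inl ?_)
        · rintro ρ (hρ | hρ)
          · exact Or.inl (hρ.trans hν)
          · refine Or.inl ?_
            unfold PlusLT at *
            rw [hρ.1.1]
            exact hν
        · unfold PlusLT at *
          rw [plus_cons_removeNth]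
          exact hν
    · rw [removeNth_comp_swap, Function.comp_apply, Equiv.swap_apply_left] at hswap
      rw [Function.comp_apply, Equiv.swap_apply_left]
      refine supportedOn_le ?_ hswap
      rintro ρ (hρ | ⟨⟨h1, h2, h3⟩, h4⟩)
      · rw [plus_comp_perm] at hρ
        exact Or.inl hρ
      · refine Or.inr ⟨⟨h1.trans (plus_comp_perm _ _), fun k => ?_, fun k hk => ?_⟩, ?_⟩
        · rw [← swap_succAbove]; exact h2 k
        · rw [h3 k (Fin.castSucc_lt_succ.le.trans hk), Function.comp_apply,
            Equiv.swap_apply_of_ne_of_ne]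
          · simp only [Fin.le_def, ne_eq, Fin.ext_iff, Fin.val_succ, Fin.val_castSucc] at *; omega
          · simp only [Fin.le_def, ne_eq, Fin.ext_iff, Fin.val_succ, Fin.val_castSucc] at *; omega
        · obtain ⟨k, hk⟩ := h4
          exact ⟨k, by rw [← swap_succAbove]; exact hk⟩

/-- The exponents which occur in `T_i ⋯ T_{n-1} x ^ ν` with the rearrangement of `ν`. -/
def LeftBound (i : Fin (n + 1)) (ν ρ : Fin (n + 1) → ℤ) : Prop :=
  plus ρ = plus ν ∧ (∀ k : Fin n, ν k.castSucc ≤ ρ (i.succAbove k)) ∧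
    ∀ k : Fin n, k.castSucc < i → ρ k.castSucc = ν k.castSucc

theorem plus_insertNth (i : Fin (n + 1)) (ν : Fin (n + 1) → ℤ) :
    plus (Fin.insertNth (α := fun _ => ℤ) i (ν (Fin.last n)) (Fin.init ν)) = plus ν := by
  have h1 := plus_cons_removeNth i
    (Fin.insertNth (α := fun _ => ℤ) i (ν (Fin.last n)) (Fin.init ν))
  have h2 := plus_cons_removeNth (Fin.last n) ν
  rw [Fin.removeNth_insertNth, Fin.insertNth_apply_same] at h1
  rw [Fin.removeNth_last] at h2
  exact h1.symm.trans h2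

theorem leftBound_insertNth (i : Fin (n + 1)) (ν : Fin (n + 1) → ℤ) :
    LeftBound i ν (Fin.insertNth (α := fun _ => ℤ) i (ν (Fin.last n)) (Fin.init ν)) := by
  refine ⟨plus_insertNth i ν, fun k => ?_, fun k hk => ?_⟩
  · rw [Fin.insertNth_apply_succAbove]; rfl
  · rw [← Fin.succAbove_of_castSucc_lt i k hk, Fin.insertNth_apply_succAbove,
      Fin.succAbove_of_castSucc_lt i k hk]
    rfl

theorem insertNth_comp_swap (j : Fin n) (c : ℤ) (r : Fin n → ℤ) :
    Fin.insertNth (α := fun _ => ℤ) j.succ c r ∘ Equiv.swap j.castSucc j.succ =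
      Fin.insertNth (α := fun _ => ℤ) j.castSucc c r := by
  rw [Fin.eq_insertNth_iff, removeNth_comp_swap, Fin.removeNth_insertNth, Function.comp_apply,
    Equiv.swap_apply_left, Fin.insertNth_apply_same]
  exact ⟨rfl, rfl⟩

/-- The last exponent travels back to position i, with a factor t for each part passed that is at
most its size. Here T_j acts last, and not swapping makes the bound at j strict. -/
theorem leftProd_mono (t : K) (i : Fin (n + 1)) (ν : Fin (n + 1) → ℤ) :
    leftProd t i (mono ν) - t ^ (Finset.univ.filter fun k : Fin n =>
        i ≤ k.castSucc ∧ ν k.castSucc ≤ ν (Fin.last n)).card •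
          mono (Fin.insertNth (α := fun _ => ℤ) i (ν (Fin.last n)) (Fin.init ν)) ∈
      supportedOn K fun ρ => PlusLT (plus ν) ρ ∨
        LeftBound i ν ρ ∧ ∃ k : Fin n, ρ (i.succAbove k) ≠ ν k.castSucc := by
  induction i using Fin.reverseInduction with
  | last =>
    rw [leftProd_last, Module.End.one_apply, Fin.insertNth_last', Fin.snoc_init_self]
    rw [Finset.filter_false_of_mem fun k _ h => (Fin.castSucc_lt_last k).not_ge h.1]
    simp
  | cast j ih =>
    rw [leftProd_castSucc, Module.End.mul_apply, card_filter_le_castSucc, pow_add]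
    refine map_sub_smul_mem ih (fun ρ hρ => ?_) ?_
    · rcases hρ with hρ | ⟨⟨h1, h2, h3⟩, k, hk⟩
      · refine mem_of_sub_smul_mem (supportedOn_le ?_ (T_mono t j ρ)) (Or.inl ?_)
        · rintro σ (⟨rfl, -⟩ | hσ)
          · exact Or.inl hρ
          · exact Or.inl (hσ.trans hρ)
        · unfold PlusLT at *
          rw [plus_comp_perm]
          exact hρ
      · refine mem_of_sub_smul_mem (supportedOn_le ?_ (T_mono t j ρ)) (Or.inr ⟨⟨?_, fun l => ?_,
          fun l hl => ?_⟩, k, ?_⟩)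
        · rintro σ (⟨rfl, hσ⟩ | hσ)
          · have hj : ν j.castSucc < σ (j.castSucc.succAbove j) := by
              rw [← h3 j Fin.castSucc_lt_succ, Fin.succAbove_castSucc_self]
              exact hσ
            refine Or.inr ⟨⟨h1, fun l => ?_, fun l hl => h3 l (hl.trans Fin.castSucc_lt_succ)⟩,
              j, hj.ne'⟩
            by_cases hlj : l = j
            · rw [hlj]; exact hj.le
            · rw [succAbove_castSucc_eq hlj]; exact h2 l
          · exact Or.inl (h1 ▸ hσ)
        · rw [plus_comp_perm]; exact h1
        · rw [Function.comp_apply, swap_succAbove]; exact h2 l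
        · rw [Function.comp_apply, Equiv.swap_apply_of_ne_of_ne hl.ne
            (hl.trans Fin.castSucc_lt_succ).ne]
          exact h3 l (hl.trans Fin.castSucc_lt_succ)
        · rw [Function.comp_apply, swap_succAbove]; exact hk
    · have hT := T_mono t j
        (Fin.insertNth (α := fun _ => ℤ) j.succ (ν (Fin.last n)) (Fin.init ν))
      have hc : Fin.insertNth (α := fun _ => ℤ) j.succ (ν (Fin.last n)) (Fin.init ν) j.castSucc =
          ν j.castSucc := (leftBound_insertNth j.succ ν).2.2 j Fin.castSucc_lt_succ
      rw [insertNth_comp_swap, Fin.insertNth_apply_same, hc] at hT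
      refine supportedOn_le ?_ hT
      obtain ⟨h1, h2, h3⟩ := leftBound_insertNth j.succ ν
      rintro σ (⟨rfl, hσ⟩ | hσ)
      · have hj : ν j.castSucc < Fin.insertNth (α := fun _ => ℤ) j.succ (ν (Fin.last n))
            (Fin.init ν) (j.castSucc.succAbove j) := by
          rw [Fin.succAbove_castSucc_self, Fin.insertNth_apply_same]
          exact hσ
        refine Or.inr ⟨⟨h1, fun l => ?_, fun l hl => h3 l (hl.trans Fin.castSucc_lt_succ)⟩,
          j, hj.ne'⟩
        by_cases hlj : l = j
        · rw [hlj]; exact hj.le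
        · rw [succAbove_castSucc_eq hlj]; exact h2 l
      · rw [plus_insertNth] at hσ
        exact Or.inl hσ

/-- Partial sums ending before i are compared termwise, the others through their complements, the
totals being equal. No bound is needed at i itself. -/
theorem prec_of_bounds {ρ μ : Fin (n + 1) → ℤ} (i : Fin (n + 1)) (hp : plus ρ = plus μ)
    (hne : ρ ≠ μ) (h1 : ∀ k, k < i → ρ k ≤ μ k) (h2 : ∀ k, i < k → μ k ≤ ρ k) : Prec ρ μ := by
  have hs : ∑ k, ρ k = ∑ k, μ k := by
    rw [← sum_plus_comp ρ fun x => x, hp, sum_plus_comp _ fun x => x]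
  refine ⟨hs, Or.inr ⟨hp, hne, fun p => ?_⟩⟩
  rcases lt_or_ge p i with h | h
  · exact Finset.sum_le_sum fun k hk => h1 k ((Finset.mem_Iic.1 hk).trans_lt h)
  · have h3 := Finset.sum_add_sum_compl (Finset.Iic p) ρ
    have h4 := Finset.sum_add_sum_compl (Finset.Iic p) μ
    have h5 : ∑ k ∈ (Finset.Iic p)ᶜ, μ k ≤ ∑ k ∈ (Finset.Iic p)ᶜ, ρ k :=
      Finset.sum_le_sum fun k hk => h2 k (h.trans_lt (by simpa using hk))
    linarith

/-- Exponent count for the eigenvalue: it collects the powers of t from the left product, the right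
product and the normalisation t^{i-n}. -/
theorem legColength_add (μ : Fin (n + 1) → ℤ) (i : Fin (n + 1)) :
    legColength μ i + (Finset.univ.filter fun k : Fin n =>
        i ≤ k.castSucc ∧ i.removeNth μ k ≤ μ i).card + i =
      (Finset.univ.filter fun k => k < i ∧ μ i ≤ μ k).card + n := by
  have h1 : (Finset.univ.filter fun k => i < k ∧ μ i < μ k) =
      (Finset.univ.filter fun k : Fin n => i ≤ k.castSucc ∧ ¬ i.removeNth μ k ≤ μ i).map
        (Fin.succEmb n) := by
    ext k
    simp only [Finset.mem_filter, Finset.mem_univ, true_and, Finset.mem_map, not_le,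
      Fin.coe_succEmb]
    constructor
    · rintro ⟨h, h'⟩
      obtain ⟨l, rfl⟩ := Fin.exists_succ_eq.2 ((Fin.zero_le i).trans_lt h).ne'
      have hl : i ≤ l.castSucc := Fin.le_castSucc_iff.2 h
      exact ⟨l, ⟨hl, by rwa [Fin.removeNth_apply, Fin.succAbove_of_le_castSucc _ _ hl]⟩, rfl⟩
    · rintro ⟨l, ⟨hl, h⟩, rfl⟩
      rw [Fin.removeNth_apply, Fin.succAbove_of_le_castSucc _ _ hl] at h
      exact ⟨Fin.le_castSucc_iff.1 hl, h⟩
  have h2 : (Finset.univ.filter fun k : Fin n => i ≤ k.castSucc).card + i = n := by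
    have h3 := Finset.card_filter_add_card_filter_not (s := (Finset.univ : Finset (Fin n)))
      (fun k : Fin n => i ≤ k.castSucc)
    have h4 : (Finset.univ.filter fun k : Fin n => ¬ i ≤ k.castSucc).card = i := by
      have : (Finset.univ.filter fun k : Fin n => ¬ i ≤ k.castSucc) =
          Finset.univ.filter fun k : Fin n => (k : ℕ) < i := by
        ext k; simp [Fin.lt_def]
      rw [this, Fin.card_filter_val_lt]
      omega
    rw [h4, Finset.card_univ, Fintype.card_fin] at h3
    exact h3
  have h5 := Finset.card_filter_add_card_filter_not
    (s := Finset.univ.filter fun k : Fin n => i ≤ k.castSucc) (fun k => i.removeNth μ k ≤ μ i)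
  rw [Finset.filter_filter, Finset.filter_filter] at h5
  rw [legColength, h1, Finset.card_map]
  omega

/-- The Cherednik operators are triangular on monomials. -/
theorem Y_mono {q t : K} (ht : t ≠ 0) (i : Fin (n + 1)) (μ : Fin (n + 1) → ℤ) :
    Y q t i (mono μ) - (q ^ μ i * t ^ (-(legColength μ i : ℤ))) • mono μ ∈
      supportedOn K fun ν => Prec ν μ := by
  have hω : ∀ ν : Fin (n + 1) → ℤ, ∃ ν' : Fin (n + 1) → ℤ, plus ν' = plus ν ∧
      (∀ k : Fin n, ν' k.castSucc = ν k.succ) ∧ ν' (Fin.last n) = ν 0 ∧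
        omega q (mono ν : Laurent K n) = q ^ ν 0 • mono ν' := fun ν =>
    ⟨_, plus_comp_perm ν (finRotate (n + 1)), fun k => by
      rw [Function.comp_apply, finRotate_castSucc], by rw [Function.comp_apply, finRotate_last],
      omega_mono q ν⟩
  have hlt : ∀ (k : Fin n), k.castSucc < i → i.succAbove k = k.castSucc := fun k hk =>
    Fin.succAbove_of_castSucc_lt i k hk
  have hge : ∀ (k : Fin n), i ≤ k.castSucc → i.succAbove k = k.succ := fun k hk =>
    Fin.succAbove_of_le_castSucc i k hk
  -- The bounds chain through the shift by ω: ρ_l = ν_{l+1} ≤ μ_l before position i, and μ_l = ν_l ≤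
  -- ρ_l after it.
  have hbound : ∀ ν ν' ρ : Fin (n + 1) → ℤ, plus ν' = plus ν →
      (∀ k : Fin n, ν' k.castSucc = ν k.succ) → RightBound i μ ν → LeftBound i ν' ρ →
        (∃ k : Fin n, ρ (i.succAbove k) ≠ μ (i.succAbove k)) → Prec ρ μ := by
    rintro ν ν' ρ hp hν ⟨h1, h2, h3⟩ ⟨h4, h5, h6⟩ ⟨k, hk⟩
    refine prec_of_bounds i (h4.trans (hp.trans h1)) (fun e => hk (e ▸ rfl)) (fun l hl => ?_)
      fun l hl => ?_
    · obtain ⟨l, rfl⟩ := Fin.exists_castSucc_eq.2 (hl.trans_le (Fin.le_last i)).ne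
      rw [h6 l hl, hν, ← hlt l hl]
      exact h2 l
    · obtain ⟨l, rfl⟩ := Fin.exists_succ_eq.2 ((Fin.zero_le i).trans_lt hl).ne'
      have hl' := Fin.le_castSucc_iff.2 hl
      rw [← h3 l hl', ← hν, ← hge l hl']
      exact h5 l
  have herr : ∀ ν : Fin (n + 1) → ℤ, (PlusLT (plus μ) ν ∨
      RightBound i μ ν ∧ ∃ k : Fin n, ν k.succ ≠ μ (i.succAbove k)) →
        (leftProd t i * omega q : Module.End K (Laurent K n)) (mono ν) ∈ supportedOn K fun ρ => Prec ρ μ := by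
    intro ν hν
    obtain ⟨ν', hp, hν', -, hω'⟩ := hω ν
    rw [Module.End.mul_apply, hω', map_smul]
    refine Submodule.smul_mem _ _ ?_
    have key : ∀ ρ, PlusLT (plus ν') ρ ∨ LeftBound i ν' ρ → Prec ρ μ := by
      rw [hp]
      rintro ρ hρ
      rcases hν with hν | ⟨hν, k, hk⟩
      · rcases hρ with hρ | hρ
        · exact (hρ.trans hν).prec
        · refine PlusLT.prec ?_
          unfold PlusLT at *
          rw [hρ.1, hp]
          exact hν
      · rcases hρ with hρ | hρ
        · exact PlusLT.prec (hν.1 ▸ hρ)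
        -- A deviation of ν from μ must lie before i, where the left product leaves it visible in ρ;
        -- after i there is none.
        · refine hbound ν ν' ρ hp hν' hν hρ ⟨k, fun e => hk ?_⟩
          rcases lt_or_ge k.castSucc i with h | h
          · rw [← hν', ← hρ.2.2 k h, ← hlt k h, e]
          · rw [hge k h, hν.2.2 k h]
    refine mem_of_sub_smul_mem (supportedOn_le (fun ρ hρ => key ρ ?_) (leftProd_mono t i ν'))
      (key _ (Or.inr (leftBound_insertNth i ν')))
    exact hρ.imp id And.left
  obtain ⟨ν', hp, hν', hlast, hω'⟩ := hω (Fin.cons (μ i) (i.removeNth μ))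
  have hν'' : Fin.init ν' = i.removeNth μ := funext fun k => by
    rw [Fin.init, hν', Fin.cons_succ]
  rw [Fin.cons_zero] at hlast hω'
  have hL := leftProd_mono t i ν'
  have hk : ∀ k : Fin n, ν' k.castSucc = i.removeNth μ k := fun k => congrFun hν'' k
  rw [hlast, hν'', Fin.insertNth_self_removeNth] at hL
  simp only [hk] at hL
  have hlead : (leftProd t i * omega q : Module.End K (Laurent K n))
      (mono (Fin.cons (μ i) (i.removeNth μ))) -
      (q ^ μ i * t ^ (Finset.univ.filter fun k : Fin n =>
        i ≤ k.castSucc ∧ i.removeNth μ k ≤ μ i).card) • mono μ ∈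
        supportedOn K fun ρ => Prec ρ μ := by
    rw [Module.End.mul_apply, hω', map_smul, mul_smul, ← smul_sub]
    refine Submodule.smul_mem _ _ (supportedOn_le ?_ hL)
    rintro ρ (hρ | ⟨hρ, k, hk⟩)
    · rw [hp, plus_cons_removeNth] at hρ
      exact hρ.prec
    · refine hbound _ ν' ρ hp hν' (rightBound_cons i μ) hρ ⟨k, fun e => hk ?_⟩
      rw [e, Fin.removeNth_apply]
  have h := Submodule.smul_mem _ (t ^ ((i : ℤ) - n))
    (map_sub_smul_mem (rightProd_mono ht i μ) herr hlead)
  rw [smul_sub, smul_smul] at h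
  have hc := legColength_add μ i
  generalize (Finset.univ.filter fun k => k < i ∧ μ i ≤ μ k).card = a at *
  generalize (Finset.univ.filter fun k : Fin n => i ≤ k.castSucc ∧ i.removeNth μ k ≤ μ i).card = b
    at *
  have hcoef : q ^ μ i * t ^ (-(legColength μ i : ℤ)) =
      t ^ ((i : ℤ) - n) * (q ^ μ i * t ^ b * t⁻¹ ^ a) := by
    rw [inv_pow, ← zpow_natCast, ← zpow_natCast, ← zpow_neg,
      show -(legColength μ i : ℤ) = ((i : ℤ) - n) + b + -a by omega, zpow_add₀ ht, zpow_add₀ ht]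
    ring
  rw [hcoef]
  exact h

end Triangularity

/-! ### Separation of eigenvalues, existence, uniqueness and the flip. -/

section Eigenfunctions

variable {K : Type*} [Field K] {n : ℕ} {q t : K}

/-- The eigenvalue `q ^ {η_i} t ^ {-l'_η(i)}` of `Y_i` on the Macdonald polynomial of `η`. -/
noncomputable def eigenvalue (q t : K) (η : Fin (n + 1) → ℤ) (i : Fin (n + 1)) : K :=
  q ^ η i * t ^ (-(legColength η i : ℤ))

/-- Genericity only covers nonnegative exponents, so a relation may survive when the signs differ.
This weaker conclusion is just what `eq_of_plus_le` can exclude. -/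
theorem exponents_of_zpow_mul_zpow_eq_one
    (hqt : ∀ a b : ℕ, q ^ a * t ^ b = 1 → a = 0 ∧ b = 0) {a : ℤ} {b : ℕ}
    (h : q ^ a * t ^ b = 1) : 0 < b ∧ a < 0 ∨ b = 0 ∧ a = 0 := by
  rcases le_or_gt 0 a with ha | ha
  · lift a to ℕ using ha
    obtain ⟨h1, h2⟩ := hqt a b (by rwa [zpow_natCast] at h)
    right; omega
  · refine Or.inl ⟨Nat.pos_of_ne_zero fun hb => ?_, ha⟩
    obtain ⟨c, rfl⟩ : ∃ c : ℕ, a = -c := ⟨(-a).toNat, by omega⟩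
    rw [hb, pow_zero, mul_one, zpow_neg, zpow_natCast, inv_eq_one] at h
    have := (hqt c 0 (by rw [h, pow_zero, one_mul])).1
    omega

/-- If all eigenvalues agreed, a larger leg colength of ν would force a larger part and an equal one
an equal part; `eq_of_plus_le` then gives ν = η. -/
theorem exists_eigenvalue_ne (hq : q ≠ 0) (ht : t ≠ 0)
    (hqt : ∀ a b : ℕ, q ^ a * t ^ b = 1 → a = 0 ∧ b = 0) {ν η : Fin (n + 1) → ℤ}
    (h : Prec ν η) : ∃ i, eigenvalue q t ν i ≠ eigenvalue q t η i := by
  by_contra! he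
  have key : ∀ i, legColength η i ≤ legColength ν i →
      0 < legColength ν i - legColength η i ∧ η i - ν i < 0 ∨
        legColength ν i - legColength η i = 0 ∧ η i - ν i = 0 := fun i hi => by
    refine exponents_of_zpow_mul_zpow_eq_one hqt ?_
    rw [← zpow_natCast, show ((legColength ν i - legColength η i : ℕ) : ℤ) =
      -(legColength η i : ℤ) - -(legColength ν i : ℤ) by omega, zpow_sub₀ hq, zpow_sub₀ ht,
      div_mul_div_comm, div_eq_one_iff_eq (mul_ne_zero (zpow_ne_zero _ hq) (zpow_ne_zero _ ht))]
    exact (he i).symm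
  have heq : ν = η := eq_of_plus_le h.plus_le
    (fun i hi => by have := key i hi.le; omega) (fun i hi => by have := key i hi.le; omega)
  exact Prec.irrefl η (heq ▸ h)

/-- A numerical height for ≺, used to pick maximal exponents in finite sets. -/
theorem ncard_prec_lt {ν η : Fin (n + 1) → ℤ} (h : Prec ν η) :
    {ρ | Prec ρ ν}.ncard < {ρ | Prec ρ η}.ncard :=
  Set.ncard_lt_ncard ⟨fun _ hρ => hρ.trans h, fun hs => Prec.irrefl ν (hs h)⟩ (finite_prec η)

theorem Y_sub_eigenvalue_mono (ht : t ≠ 0) (i : Fin (n + 1)) (η : Fin (n + 1) → ℤ) :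
    (Y q t i - eigenvalue q t η i • 1 : Module.End K (Laurent K n)) (mono η) ∈
      supportedOn K fun ν => Prec ν η := by
  rw [LinearMap.sub_apply, LinearMap.smul_apply, Module.End.one_apply]
  exact Y_mono ht i η

theorem sub_smul_one_mono_mem (ht : t ≠ 0) (i : Fin (n + 1)) (c : K) (η : Fin (n + 1) → ℤ) :
    (Y q t i - c • 1 : Module.End K (Laurent K n)) (mono η) -
      (eigenvalue q t η i - c) • mono η ∈ supportedOn K fun ν => Prec ν η := by
  have h := Y_sub_eigenvalue_mono (q := q) ht i η
  rw [LinearMap.sub_apply, LinearMap.smul_apply, Module.End.one_apply] at *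
  rw [sub_smul, sub_sub_sub_cancel_right]
  exact h

/-- A polynomial in the Cherednik operators which annihilates the monomials in a lower set `S`
below `η` and multiplies `x ^ η` by a nonzero constant, up to lower terms. -/
theorem exists_annihilator (hq : q ≠ 0) (ht : t ≠ 0)
    (hqt : ∀ a b : ℕ, q ^ a * t ^ b = 1 → a = 0 ∧ b = 0) (η : Fin (n + 1) → ℤ)
    (S : Finset (Fin (n + 1) → ℤ)) (hS : ∀ ν ∈ S, Prec ν η)
    (hS' : ∀ ν ∈ S, ∀ ρ, Prec ρ ν → ρ ∈ S) :
    ∃ (A : Module.End K (Laurent K n)) (c : K), c ≠ 0 ∧ (∀ i, Commute (Y q t i) A) ∧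
      (∀ f ∈ supportedOn K (· ∈ S), A f = 0) ∧
      (∀ f ∈ supportedOn K (Prec · η), A f ∈ supportedOn K (Prec · η)) ∧
      A (mono η) - c • mono η ∈ supportedOn K (Prec · η) := by
  induction hn : S.card generalizing S with
  | zero =>
    rw [Finset.card_eq_zero] at hn
    subst hn
    refine ⟨1, 1, one_ne_zero, fun i => Commute.one_right _, fun f hf => ?_, fun f hf => hf, ?_⟩
    · rw [Module.End.one_apply, ← AddMonoidAlgebra.coeff_eq_zero]
      ext ν
      by_contra hν
      exact Finset.notMem_empty ν (hf ν hν)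
    · rw [Module.End.one_apply, one_smul, sub_self]
      exact Submodule.zero_mem _
  | succ m ih =>
    -- Removing a maximal ν leaves a lower set, and Y_i minus its eigenvalue at ν maps the span of S
    -- into the span of what is left.
    obtain ⟨ν, hν, hmax⟩ := Finset.exists_max_image S (fun ν => {ρ | Prec ρ ν}.ncard)
      (Finset.card_pos.1 (by omega))
    have hmax' : ∀ ρ ∈ S, ¬ Prec ν ρ := fun ρ hρ h => (ncard_prec_lt h).not_ge (hmax ρ hρ)
    have hne : ∀ ρ ∈ S, ∀ σ, Prec σ ρ → σ ∈ S.erase ν := fun ρ hρ σ hσ =>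
      Finset.mem_erase.2 ⟨fun e => hmax' ρ hρ (e ▸ hσ), hS' ρ hρ σ hσ⟩
    obtain ⟨A, c, hc, hA, hker, hpres, hlead⟩ := ih (S.erase ν)
      (fun ρ hρ => hS ρ (Finset.mem_of_mem_erase hρ))
      (fun ρ hρ => hne ρ (Finset.mem_of_mem_erase hρ))
      (by rw [Finset.card_erase_of_mem hν, hn, Nat.add_sub_cancel])
    -- The index i is chosen to separate ν from η, so that the new factor does not kill x^η.
    obtain ⟨i, hi⟩ := exists_eigenvalue_ne hq ht hqt (hS ν hν)
    refine ⟨A * (Y q t i - eigenvalue q t ν i • 1), c * (eigenvalue q t η i - eigenvalue q t ν i),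
      mul_ne_zero hc (sub_ne_zero.2 hi.symm), fun k => (hA k).mul_right
        ((Y_commute hq ht k i).sub_right ((Commute.one_right _).smul_right _)), fun f hf => ?_,
      fun f hf => ?_, ?_⟩
    · refine hker _ (map_mem_supportedOn (fun ρ hρ => ?_) hf)
      by_cases hρν : ρ = ν
      · rw [hρν]
        exact supportedOn_le (hne ν hν) (Y_sub_eigenvalue_mono ht i ν)
      · exact mem_of_sub_smul_mem (supportedOn_le (hne ρ hρ) (sub_smul_one_mono_mem ht i _ ρ))
          (Finset.mem_erase.2 ⟨hρν, hρ⟩)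
    · refine hpres _ (map_mem_supportedOn (fun ρ hρ => ?_) hf)
      exact mem_of_sub_smul_mem (supportedOn_le (fun σ hσ => Prec.trans hσ hρ)
        (sub_smul_one_mono_mem ht i _ ρ)) hρ
    · rw [Module.End.mul_apply]
      exact map_sub_smul_mem (sub_smul_one_mono_mem ht i _ η)
        (fun ρ hρ => hpres _ (mono_mem_supportedOn hρ)) hlead

theorem isMacdonald_iff {η : Fin (n + 1) → ℤ} {f : Laurent K n} :
    IsMacdonald q t η f ↔ f - mono η ∈ supportedOn K (Prec · η) ∧
      ∀ i, Y q t i f = eigenvalue q t η i • f := by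
  rw [IsMacdonald, ← and_assoc]
  refine and_congr_left fun _ => ⟨fun ⟨h1, h2⟩ ν hν => ?_, fun h => ⟨?_, fun ν hν => ?_⟩⟩
  · rw [AddMonoidAlgebra.coeff_sub, Finsupp.sub_apply] at hν
    by_cases e : η = ν
    · rw [← e, h1, coeff_mono_self, sub_self] at hν
      exact absurd rfl hν
    · rw [coeff_mono_of_ne e, sub_zero] at hν
      exact (h2 ν hν).resolve_left (Ne.symm e)
  · have h1 := not_not.1 (mt (h η) (Prec.irrefl η))
    rw [AddMonoidAlgebra.coeff_sub, Finsupp.sub_apply, coeff_mono_self] at h1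
    exact sub_eq_zero.1 h1
  · by_cases e : η = ν
    · exact Or.inl e.symm
    · refine Or.inr (h ν ?_)
      rwa [AddMonoidAlgebra.coeff_sub, Finsupp.sub_apply, coeff_mono_of_ne e, sub_zero]

/-- With A annihilating everything below η, it kills (Y_i - λ_i) x^η by triangularity; as A commutes
with Y_i, the vector A x^η is a joint eigenvector. -/
theorem exists_isMacdonald (hq : q ≠ 0) (ht : t ≠ 0)
    (hqt : ∀ a b : ℕ, q ^ a * t ^ b = 1 → a = 0 ∧ b = 0) (η : Fin (n + 1) → ℤ) :
    ∃ f, IsMacdonald q t η f := by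
  obtain ⟨A, c, hc, hA, hker, -, hlead⟩ := exists_annihilator hq ht hqt η (finite_prec η).toFinset
    (fun ν hν => (finite_prec η).mem_toFinset.1 hν) (fun ν hν ρ hρ =>
      (finite_prec η).mem_toFinset.2 (hρ.trans ((finite_prec η).mem_toFinset.1 hν)))
  refine ⟨c⁻¹ • A (mono η), isMacdonald_iff.2 ⟨?_, fun i => ?_⟩⟩
  · have h := Submodule.smul_mem _ c⁻¹ hlead
    rwa [smul_sub, smul_smul, inv_mul_cancel₀ hc, one_smul] at h
  · have h := hker _ (supportedOn_le (fun ν hν => (finite_prec η).mem_toFinset.2 hν)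
      (Y_sub_eigenvalue_mono (q := q) ht i η))
    rw [LinearMap.sub_apply, LinearMap.smul_apply, Module.End.one_apply, map_sub, map_smul,
      ← Module.End.mul_apply, ← (hA i).eq, sub_eq_zero] at h
    rw [map_smul, ← Module.End.mul_apply, h, smul_comm]

/-- A nonzero difference is a joint eigenvector supported strictly below η. At a maximal exponent ν,
triangularity forces its eigenvalues to be those of ν, against separation. -/
theorem isMacdonald_unique (hq : q ≠ 0) (ht : t ≠ 0)
    (hqt : ∀ a b : ℕ, q ^ a * t ^ b = 1 → a = 0 ∧ b = 0) {η : Fin (n + 1) → ℤ} {f g : Laurent K n}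
    (hf : IsMacdonald q t η f) (hg : IsMacdonald q t η g) : f = g := by
  rw [isMacdonald_iff] at hf hg
  by_contra hne
  set h := f - g with hh
  have hsupp : h ∈ supportedOn K (Prec · η) := by
    have := Submodule.sub_mem _ hf.1 hg.1
    rwa [sub_sub_sub_cancel_right] at this
  have hY : ∀ i, Y q t i h = eigenvalue q t η i • h := fun i => by
    rw [hh, map_sub, hf.2, hg.2, smul_sub]
  have h0 : h.coeff.support.Nonempty := by
    rw [Finsupp.support_nonempty_iff, ne_eq, AddMonoidAlgebra.coeff_eq_zero]
    exact sub_ne_zero.2 hne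
  obtain ⟨ν, hν, hmax⟩ := Finset.exists_max_image _ (fun ν => {ρ | Prec ρ ν}.ncard) h0
  have hν' := Finsupp.mem_support_iff.1 hν
  obtain ⟨i, hi⟩ := exists_eigenvalue_ne hq ht hqt (hsupp ν hν')
  refine hi (mul_right_cancel₀ hν' ?_)
  -- By maximality of ν no other exponent lies above it, so the remaining terms cannot contribute to
  -- the coefficient of x^ν in Y_i h.
  have h1 : h - h.coeff ν • mono ν ∈ supportedOn K fun ρ => ρ ≠ ν ∧ ¬ Prec ν ρ := fun ρ hρ => by
    rw [AddMonoidAlgebra.coeff_sub, Finsupp.sub_apply, AddMonoidAlgebra.coeff_smul,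
      Finsupp.smul_apply] at hρ
    by_cases e : ν = ρ
    · rw [← e, coeff_mono_self, smul_eq_mul, mul_one, sub_self] at hρ
      exact absurd rfl hρ
    · rw [coeff_mono_of_ne e, smul_zero, sub_zero] at hρ
      exact ⟨Ne.symm e, fun hp =>
        (ncard_prec_lt hp).not_ge (hmax ρ (Finsupp.mem_support_iff.2 hρ))⟩
  have h2 : Y q t i h - (eigenvalue q t ν i * h.coeff ν) • mono ν ∈
      supportedOn K fun ρ => ρ ≠ ν := by
    refine map_sub_smul_mem h1 (fun ρ hρ => ?_)
      (supportedOn_le (fun ρ (hρ : Prec ρ ν) (e : ρ = ν) => Prec.irrefl ν (e ▸ hρ)) (Y_mono ht i ν))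
    exact mem_of_sub_smul_mem (supportedOn_le (fun σ (hσ : Prec σ ρ) (e : σ = ν) => hρ.2 (e ▸ hσ))
      (Y_mono ht i ρ)) hρ.1
  have h3 := not_not.1 (mt (h2 ν) fun e => e rfl)
  rw [hY, AddMonoidAlgebra.coeff_sub, Finsupp.sub_apply, AddMonoidAlgebra.coeff_smul,
    AddMonoidAlgebra.coeff_smul, Finsupp.smul_apply, Finsupp.smul_apply, coeff_mono_self,
    smul_eq_mul, smul_eq_mul, mul_one, sub_eq_zero] at h3
  exact h3.symm

theorem E_isMacdonald (hq : q ≠ 0) (ht : t ≠ 0)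
    (hqt : ∀ a b : ℕ, q ^ a * t ^ b = 1 → a = 0 ∧ b = 0) (η : Fin (n + 1) → ℤ) :
    IsMacdonald q t η (E q t η) := by
  rw [E, dif_pos (exists_isMacdonald hq ht hqt η)]
  exact (exists_isMacdonald hq ht hqt η).choose_spec

/-- By `Y_flipInv_Y` the flip inverts eigenvalues up to t^{-n}; parts cancel in the power of q, and
leg colengths add to n in the power of t. -/
theorem IsMacdonald.flipInv (hq : q ≠ 0) (ht : t ≠ 0) {η : Fin (n + 1) → ℤ} {f : Laurent K n}
    (hf : IsMacdonald q t η f) : IsMacdonald q t (negRev η) (flipInv f) := by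
  rw [isMacdonald_iff] at *
  refine ⟨?_, fun i => ?_⟩
  · rw [← flipInv_mono, ← map_sub]
    exact map_mem_supportedOn (fun ν hν => by
      rw [flipInv_mono]; exact mono_mem_supportedOn (Prec.negRev hν)) hf.1
  · have h := Y_flipInv_Y hq ht i.rev f
    have hl := legColength_negRev η i.rev
    rw [Fin.rev_rev] at h hl
    rw [hf.2, map_smul, map_smul] at h
    have he : eigenvalue q t (negRev η) i * eigenvalue q t η i.rev = t ^ (-(n : ℤ)) := by
      rw [eigenvalue, eigenvalue, mul_mul_mul_comm, ← zpow_add₀ hq, ← zpow_add₀ ht]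
      simp only [negRev, neg_add_cancel, zpow_zero, one_mul]
      congr 1
      omega
    have h0 : eigenvalue q t η i.rev ≠ 0 := mul_ne_zero (zpow_ne_zero _ hq) (zpow_ne_zero _ ht)
    rw [← he, mul_comm, mul_smul] at h
    exact smul_right_injective _ h0 h

theorem invVars_E (hq : q ≠ 0) (ht : t ≠ 0)
    (hqt : ∀ a b : ℕ, q ^ a * t ^ b = 1 → a = 0 ∧ b = 0) (η : Fin (n + 1) → ℤ) :
    invVars (E q t η) = revVars (E q t (negRev η)) := by
  rw [← isMacdonald_unique hq ht hqt ((E_isMacdonald hq ht hqt η).flipInv hq ht)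
    (E_isMacdonald hq ht hqt (negRev η)), flipInv, Module.End.mul_apply, revVars_revVars]

end Eigenfunctions

end NonsymMacdonald

theorem mainTheorem8 {K : Type*} [Field K] (n : ℕ) (q t : K) (hq : q ≠ 0) (ht : t ≠ 0)
    (hqt : ∀ a b : ℕ, q ^ a * t ^ b = 1 → a = 0 ∧ b = 0) (η : Fin (n + 1) → ℤ) :
    (∃! f : NonsymMacdonald.Laurent K n, NonsymMacdonald.IsMacdonald q t η f) ∧
    NonsymMacdonald.invVars (NonsymMacdonald.E q t η) =
      NonsymMacdonald.revVars (NonsymMacdonald.E q t (NonsymMacdonald.negRev η)) ∧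
    NonsymMacdonald.invVars (NonsymMacdonald.Ehat q t η) =
      NonsymMacdonald.revVars (NonsymMacdonald.Ehat q t (NonsymMacdonald.negRev η)) := by
  obtain ⟨f, hf⟩ := NonsymMacdonald.exists_isMacdonald hq ht hqt η
  refine ⟨⟨f, hf, fun g hg => NonsymMacdonald.isMacdonald_unique hq ht hqt hg hf⟩,
    NonsymMacdonald.invVars_E hq ht hqt η, ?_⟩
  -- Genericity is stable under inverting both parameters, and inversion of the variables commutes
  -- with their reversal, so the dual identity is the first one at (q⁻¹, t⁻¹).
  have hqt' : ∀ a b : ℕ, q⁻¹ ^ a * t⁻¹ ^ b = 1 → a = 0 ∧ b = 0 := fun a b h =>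
    hqt a b (by rwa [inv_pow, inv_pow, ← mul_inv, inv_eq_one] at h)
  rw [NonsymMacdonald.Ehat, NonsymMacdonald.Ehat, NonsymMacdonald.invVars_revVars,
    NonsymMacdonald.invVars_E (inv_ne_zero hq) (inv_ne_zero ht) hqt']
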